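/- Let $\{\xi_{r,s}\}_{(r,s)\in\mathbb Z^2}$ be i.i.d. real random variables with the law of $\xi_0$, where $\mathbb E\xi_0=0$ and $\mathbb E\xi_0^2=1$. Let $\{a_{r,s}\}_{(r,s)\in\mathbb Z^2}$ be real numbers with $\sum_{r,s}a_{r,s}^2<\infty$, and let $X_{j,k}=\sum_{r,s\in\mathbb Z}a_{r,s}\,\xi_{j-r,k-s}$, the series converging in $L^2$. Let $\{\Gamma_n\}$ be a sequence of finite subsets of $\mathbb Z^2$ and put $$S_n=\sum_{(j,k)\in\Gamma_n}X_{j,k},\qquad b_{n,r,s}=\sum_{(j,k)\in\Gamma_n}a_{j+r,k+s},\qquad \sigma_n^2=\mathbb E S_n^2,\qquad \rho_n^2=\max_{r,s\in\mathbb Z}\frac{b_{n,r,s}^2}{\sigma_n^2},$$ $$D_{nt}=\sum_{r,s\in\mathbb Z}|b_{n,r,s}|^t,\qquad U_{nt}=(D_{n2})^{-t/2}D_{nt}.$$ Assume that $b_{n,r,s}>0$ for all $n,r,s$ and that $\rho_n^2\to0$ as $n\to\infty$. Assume that for some $t>2$ and some function $h$ slowly varying at infinity (that is, $h$ is measurable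 and positive on some half-line $[A,\infty)$ and $h(\lambda x)/h(x)\to1$ as $x\to\infty$ for every $\lambda>0$) one has $\mathbb P(\xi_0\ge x)=h(x)x^{-t}$ for all sufficiently large $x$. Let $C_t>e^{t/2}(t+2)/\sqrt2$ be a constant, let $(x_n)$ be a real sequence with $x_n\ge C_t[\ln(U_{nt}^{-1})]^{1/2}$ for all $n$, and put $y_n=x_n\sigma_n$. Then, as $n\to\infty$, $$\mathbb P(S_n\ge y_n)=(1+o(1))\sum_{r,s\in\mathbb Z}\mathbb P\big(b_{n,r,s}\,\xi_{-r,-s}\ge y_n\big)=(1+o(1))\,y_n^{-t}\sum_{r,s\in\mathbb Z}b_{n,r,s}^t\,h\!\left(\frac{y_n}{b_{n,r,s}}\right).$$ The first series converges for every $n$; for all sufficiently large $n$ the second series converges as well and $$\sum_{r,s\in\mathbb Z}\mathbb P\big(b_{n,r,s}\,\xi_{-r,-s}\ge y_n\big)=y_n^{-t}\sum_{r,s\in\mathbb Z}b_{n,r,s}^t\,h\!\left(\frac{y_n}{b_{n,r,s}}\right).$$ -/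

import Mathlib

open MeasureTheory ProbabilityTheory Filter Topology Asymptotics

namespace LinearRandomField

/-- The sum of a family of square integrable random variables, as the limit in `L²(μ)` of its
finite partial sums (a random variable, determined up to `μ`-null sets). -/
noncomputable def l2Sum {Ω ι : Type*} [MeasurableSpace Ω] (μ : Measure Ω) (f : ι → Ω → ℝ) :
    Ω → ℝ :=
  open Classical in
  ((∑' i, if hf : MemLp (f i) 2 μ then hf.toLp (f i) else 0 : Lp ℝ 2 μ) : Ω → ℝ)

/-- The linear random field `X_{j,k} = ∑_{r,s} a_{r,s} ξ_{j-r,k-s}`. -/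
noncomputable def field {Ω : Type*} [MeasurableSpace Ω] (μ : Measure Ω)
    (a : ℤ × ℤ → ℝ) (ξ : ℤ × ℤ → Ω → ℝ) (p : ℤ × ℤ) : Ω → ℝ :=
  l2Sum μ (fun (q : ℤ × ℤ) ω => a q * ξ (p - q) ω)

/-- The partial sum `S = ∑_{(j,k) ∈ G} X_{j,k}` of the field over a finite set `G ⊆ ℤ²`. -/
noncomputable def partialSum {Ω : Type*} [MeasurableSpace Ω] (μ : Measure Ω)
    (a : ℤ × ℤ → ℝ) (ξ : ℤ × ℤ → Ω → ℝ) (G : Finset (ℤ × ℤ)) (ω : Ω) : ℝ :=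
  ∑ p ∈ G, field μ a ξ p ω

/-- The standard deviation `σ = (𝔼 S²)^{1/2}`. -/
noncomputable def sigma {Ω : Type*} [MeasurableSpace Ω] (μ : Measure Ω)
    (a : ℤ × ℤ → ℝ) (ξ : ℤ × ℤ → Ω → ℝ) (G : Finset (ℤ × ℤ)) : ℝ :=
  Real.sqrt (∫ ω, (partialSum μ a ξ G ω) ^ 2 ∂μ)

/-- The coefficients `b_{r,s} = ∑_{(j,k) ∈ G} a_{j+r,k+s}`. -/
def coeff (a : ℤ × ℤ → ℝ) (G : Finset (ℤ × ℤ)) (q : ℤ × ℤ) : ℝ :=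
  ∑ p ∈ G, a (p + q)

/-- `D_t = ∑_{r,s} |b_{r,s}|^t`. -/
noncomputable def D (a : ℤ × ℤ → ℝ) (G : Finset (ℤ × ℤ)) (t : ℝ) : ℝ :=
  ∑' q : ℤ × ℤ, |coeff a G q| ^ t

/-- `U_t = D_2^{-t/2} D_t`. -/
noncomputable def U (a : ℤ × ℤ → ℝ) (G : Finset (ℤ × ℤ)) (t : ℝ) : ℝ :=
  (D a G 2) ^ (-t / 2) * D a G t

/-- `ρ² = max_{r,s} b_{r,s}² / σ²`. -/
noncomputable def rhoSq {Ω : Type*} [MeasurableSpace Ω] (μ : Measure Ω)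
    (a : ℤ × ℤ → ℝ) (ξ : ℤ × ℤ → Ω → ℝ) (G : Finset (ℤ × ℤ)) : ℝ :=
  ⨆ q : ℤ × ℤ, (coeff a G q) ^ 2 / (sigma μ a ξ G) ^ 2

/-- `h` is slowly varying at infinity: measurable and positive on some half-line `[A, ∞)`, with
`h (l x) / h x → 1` as `x → ∞` for every `l > 0`. -/
structure SlowlyVarying (h : ℝ → ℝ) : Prop where
  measurable_pos : ∃ A : ℝ, Measurable (fun x : Set.Ici A => h x) ∧ ∀ x ≥ A, 0 < h x
  tendsto_ratio : ∀ l : ℝ, 0 < l → Tendsto (fun x => h (l * x) / h x) atTop (𝓝 1)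

end LinearRandomField

open LinearRandomField

/-! One large summand decides whether the sum is large. After division by `σ_n` the sum is `∑ c_i
ζ_i` with `∑ c_i ^ 2 = 1`; write `G` for the right tail of `ξ_0` and `V = ∑ G (x / c_i)`. The claim
becomes `P(S ≥ x) ~ V`. Since `c_i ≤ 1`, all arguments `x / c_i` tend to infinity uniformly in `i`,
so regular variation `G (l z) / G z → l ^ (-t)` passes to the sums: replacing `x` by `l x`
multiplies `V` by about `l ^ (-t)`. Losses of a factor `1 ± δ` in the threshold are therefore
harmless once `δ → 0`.

Lower bound (`le_measureReal_sum_ge`): the events that exactly one summand is large while the others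
nearly cancel are disjoint, and Chebyshev controls the others.

Upper bound (`measureReal_sum_ge_le`): either one summand exceeds `(1 - δ) x`; or one exceeds `x /
4` and the remaining sum is at least `δ x` in modulus, which costs an extra `O(x ^ (-2))` by
independence; or every summand is below `x / 4`. The last case needs the Fuk–Nagaev type bound
`measureReal_sum_ge_and_lt_le`, with a moment of order `p < t`. With `A = x ^ (-p) ∑ c_i ^ p` and `s
= 4 log (1 / A) / x` it gives `O(A ^ 2)` (`exp_error_le`), provided `8 e ^ p log (1 / A) ≤ x ^ 2`;
the lower bound on `x_n` supplies this. Cauchy–Schwarz and a power lower bound for `G` give `V ≥ κ x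
^ 2 A ^ 2` (`sq_mul_le_tsum_tail`), so this case is `O(V / x ^ 2)`.

The infinite sums are limits of finite ones in `L²`, hence in probability, at the cost of one more
factor `1 ± δ`. Finally, `ρ_n → 0` forces `U_{nt} → 0`, hence `x_n → ∞`. -/

/-! ### Finite sums: the one-big-jump inequalities. -/

section FiniteSums

variable {Ω ι : Type*} [MeasurableSpace Ω] {μ : Measure Ω}

/-- A coordinate is independent of any event determined by finitely many other coordinates. -/
lemma measureReal_inter_of_notMem {X : ι → Ω → ℝ} (hind : iIndepFun X μ)
    (hX : ∀ i, Measurable (X i)) {i : ι} {T : Finset ι} (hi : i ∉ T) {B : Set ℝ}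
    (hB : MeasurableSet B) {D : Set (T → ℝ)} (hD : MeasurableSet D) :
    μ.real (X i ⁻¹' B ∩ (fun ω (j : T) => X j ω) ⁻¹' D) =
      μ.real (X i ⁻¹' B) * μ.real ((fun ω (j : T) => X j ω) ⁻¹' D) := by
  have h := hind.indepFun_finset {i} T (by simpa using hi) hX
  have hpr : Measurable (fun f : ({i} : Finset ι) → ℝ => f ⟨i, by simp⟩) := by fun_prop
  have h' := h.measure_inter_preimage_eq_mul
    ((fun f : ({i} : Finset ι) → ℝ => f ⟨i, by simp⟩) ⁻¹' B) D
    (hpr hB) hD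
  simp only [measureReal_def, ← ENNReal.toReal_mul]
  exact congrArg ENNReal.toReal h'

variable [IsProbabilityMeasure μ]

/-- Chebyshev's inequality for finite sums of independent centred random variables. -/
lemma measureReal_abs_sum_ge_le {X : ι → Ω → ℝ} (hind : iIndepFun X μ)
    (hL2 : ∀ i, MemLp (X i) 2 μ) (hmean : ∀ i, ∫ ω, X i ω ∂μ = 0)
    (T : Finset ι) {v c : ℝ} (hv : ∑ i ∈ T, ∫ ω, (X i ω) ^ 2 ∂μ ≤ v) (hc : 0 < c) :
    μ.real {ω | c ≤ |∑ i ∈ T, X i ω|} ≤ v / c ^ 2 := by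
  have hm : MemLp (∑ i ∈ T, X i) 2 μ := memLp_finsetSum' T fun i _ => hL2 i
  have h0 : ∫ ω, (∑ i ∈ T, X i) ω ∂μ = 0 := by
    simp only [Finset.sum_apply]
    rw [integral_finsetSum _ fun i _ => (hL2 i).integrable (by norm_num)]
    simp [hmean]
  have hvar : Var[∑ i ∈ T, X i; μ] ≤ v := by
    rw [IndepFun.variance_sum (fun i _ => hL2 i) fun i _ j _ hij => hind.indepFun hij]
    refine le_trans (le_of_eq (Finset.sum_congr rfl fun i _ => ?_)) hv
    rw [variance_eq_sub (hL2 i), hmean i]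
    simp
  have h := meas_ge_le_variance_div_sq hm hc
  rw [h0] at h
  simp only [sub_zero, Finset.sum_apply] at h
  refine ENNReal.toReal_le_of_le_ofReal (div_nonneg ((variance_nonneg _ _).trans hvar) (sq_nonneg c))
    (h.trans (ENNReal.ofReal_le_ofReal ?_))
  gcongr

/-- A single large summand forces a large sum, up to controlled error. -/
lemma le_measureReal_sum_ge {X : ι → Ω → ℝ} (hind : iIndepFun X μ)
    (hX : ∀ i, Measurable (X i))
    (hL2 : ∀ i, MemLp (X i) 2 μ) (hmean : ∀ i, ∫ ω, X i ω ∂μ = 0)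
    (Q : Finset ι) (hv : ∑ i ∈ Q, ∫ ω, (X i ω) ^ 2 ∂μ ≤ 1) {x δ : ℝ} (hx : 0 < x) (hδ : 0 < δ) :
    (∑ i ∈ Q, μ.real {ω | (1 + δ) * x ≤ X i ω}) *
      (1 - 1 / (δ * x) ^ 2 - ∑ i ∈ Q, μ.real {ω | (1 + δ) * x ≤ X i ω}) ≤
      μ.real {ω | x ≤ ∑ i ∈ Q, X i ω} := by
  classical
  set W := ∑ i ∈ Q, μ.real {ω | (1 + δ) * x ≤ X i ω} with hW
  -- The sum condition on the other coordinates keeps the total above `x`; the upper bound on each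
  -- of them makes the events `B i` disjoint. Failure of the two costs `1 / (δ * x) ^ 2` and `W`
  -- respectively.
  let D : (i : ι) → Set (↥(Q.erase i) → ℝ) := fun i =>
    {f | -(δ * x) ≤ ∑ j, f j} ∩ ⋂ j, {f | f j < (1 + δ) * x}
  have hD : ∀ i, MeasurableSet (D i) := fun i =>
    (measurableSet_le measurable_const (by fun_prop)).inter
      (MeasurableSet.iInter fun j => measurableSet_lt (by fun_prop) measurable_const)
  let E : ι → Set Ω := fun i => (fun ω (j : ↥(Q.erase i)) => X j ω) ⁻¹' D i
  have hE : ∀ i, MeasurableSet (E i) := fun i =>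
    (measurable_pi_lambda (fun ω (j : ↥(Q.erase i)) => X j ω) fun j => hX j) (hD i)
  let B : ι → Set Ω := fun i => X i ⁻¹' Set.Ici ((1 + δ) * x) ∩ E i
  have hBm : ∀ i, MeasurableSet (B i) := fun i => (hX i measurableSet_Ici).inter (hE i)
  have hEle : ∀ i ∈ Q, 1 - 1 / (δ * x) ^ 2 - W ≤ μ.real (E i) := by
    intro i hi
    have hsub : (E i)ᶜ ⊆ {ω | δ * x ≤ |∑ j ∈ Q.erase i, X j ω|} ∪
        ⋃ j ∈ Q.erase i, {ω | (1 + δ) * x ≤ X j ω} := by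
      intro ω hω
      by_contra hcon
      simp only [Set.mem_union, Set.mem_ofPred_eq, Set.mem_iUnion, not_or, not_le,
        not_exists] at hcon
      refine hω ⟨?_, ?_⟩
      · have := (abs_lt.1 hcon.1).1
        show -(δ * x) ≤ ∑ j : ↥(Q.erase i), X j ω
        rw [Finset.sum_coe_sort _ (fun j => X j ω)]
        exact this.le
      · simp only [Set.mem_iInter]
        intro j
        exact hcon.2 j j.2
    have h1 := measureReal_abs_sum_ge_le hind hL2 hmean (Q.erase i) (v := 1)
      (le_trans (Finset.sum_le_sum_of_subset_of_nonneg (Finset.erase_subset _ _)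
        fun _ _ _ => integral_nonneg fun _ => sq_nonneg _) hv) (mul_pos hδ hx)
    have h2 : μ.real (⋃ j ∈ Q.erase i, {ω | (1 + δ) * x ≤ X j ω}) ≤ W :=
      (measureReal_biUnion_finset_le _ _).trans
        (Finset.sum_le_sum_of_subset_of_nonneg (Finset.erase_subset _ _)
          fun _ _ _ => measureReal_nonneg)
    have h3 : μ.real (E i)ᶜ ≤ 1 / (δ * x) ^ 2 + W :=
      (measureReal_mono hsub).trans ((measureReal_union_le _ _).trans (add_le_add h1 h2))
    rw [probReal_compl_eq_one_sub (hE i)] at h3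
    linarith
  have hdisj : Set.PairwiseDisjoint (Q : Set ι) B := by
    intro i hi j hj hij
    refine Set.disjoint_left.2 fun ω hωi hωj => ?_
    have h1 : (1 + δ) * x ≤ X i ω := hωi.1
    have h2 := hωj.2.2
    simp only [Set.mem_iInter] at h2
    have h3 : X i ω < (1 + δ) * x := h2 ⟨i, Finset.mem_erase.2 ⟨hij, hi⟩⟩
    linarith
  have hsub : (⋃ i ∈ Q, B i) ⊆ {ω | x ≤ ∑ i ∈ Q, X i ω} := by
    intro ω hω
    simp only [Set.mem_iUnion] at hω
    obtain ⟨i, hi, hωi⟩ := hω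
    have h1 : (1 + δ) * x ≤ X i ω := hωi.1
    have h2 : -(δ * x) ≤ ∑ j : ↥(Q.erase i), X j ω := hωi.2.1
    rw [Finset.sum_coe_sort _ (fun j => X j ω)] at h2
    show x ≤ ∑ i ∈ Q, X i ω
    rw [← Finset.add_sum_erase _ _ hi]
    linarith
  calc W * (1 - 1 / (δ * x) ^ 2 - W)
      = ∑ i ∈ Q, μ.real {ω | (1 + δ) * x ≤ X i ω} * (1 - 1 / (δ * x) ^ 2 - W) := by
        rw [hW, Finset.sum_mul]
    _ ≤ ∑ i ∈ Q, μ.real (B i) := by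
        refine Finset.sum_le_sum fun i hi => ?_
        have := measureReal_inter_of_notMem (μ := μ) hind hX (Finset.notMem_erase i Q)
          (measurableSet_Ici (a := (1 + δ) * x)) (hD i)
        rw [show μ.real (B i) = _ from this]
        exact mul_le_mul_of_nonneg_left (hEle i hi) measureReal_nonneg
    _ = μ.real (⋃ i ∈ Q, B i) :=
        (measureReal_biUnion_finset hdisj fun i _ => hBm i).symm
    _ ≤ _ := measureReal_mono hsub

/-- Decomposition of the event that a sum is large according to the size of its summands. -/
lemma measureReal_sum_ge_le {X : ι → Ω → ℝ} (hind : iIndepFun X μ)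
    (hX : ∀ i, Measurable (X i))
    (hL2 : ∀ i, MemLp (X i) 2 μ) (hmean : ∀ i, ∫ ω, X i ω ∂μ = 0)
    (Q : Finset ι) (hv : ∑ i ∈ Q, ∫ ω, (X i ω) ^ 2 ∂μ ≤ 1) {x δ : ℝ} (hx : 0 < x) (hδ : 0 < δ)
    (y : ℝ) :
    μ.real {ω | x ≤ ∑ i ∈ Q, X i ω} ≤ ∑ i ∈ Q, μ.real {ω | (1 - δ) * x ≤ X i ω} +
      (∑ i ∈ Q, μ.real {ω | y ≤ X i ω}) * (1 / (δ * x) ^ 2) +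
      μ.real {ω | x ≤ ∑ i ∈ Q, X i ω ∧ ∀ i ∈ Q, X i ω < y} := by
  classical
  let F : ι → Set Ω := fun i => X i ⁻¹' Set.Ici y ∩
    (fun ω (j : ↥(Q.erase i)) => X j ω) ⁻¹' {f | δ * x ≤ |∑ j, f j|}
  -- If some `X i` reaches `y` but stays below `(1 - δ) * x`, the other summands must contribute at
  -- least `δ * x`.
  have hsub : {ω | x ≤ ∑ i ∈ Q, X i ω} ⊆ ((⋃ i ∈ Q, {ω | (1 - δ) * x ≤ X i ω}) ∪ ⋃ i ∈ Q, F i) ∪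
      {ω | x ≤ ∑ i ∈ Q, X i ω ∧ ∀ i ∈ Q, X i ω < y} := by
    intro ω hω
    by_contra hcon
    simp only [Set.mem_union, Set.mem_ofPred_eq, Set.mem_iUnion, not_or, not_le,
        not_exists, not_and, not_forall, not_lt] at hcon
    obtain ⟨⟨h1, h2⟩, h3⟩ := hcon
    obtain ⟨i, hi, hy⟩ := h3 hω
    refine h2 i hi ⟨hy, ?_⟩
    show δ * x ≤ |∑ j : ↥(Q.erase i), X j ω|
    rw [Finset.sum_coe_sort _ (fun j => X j ω)]
    have hω' : x ≤ ∑ i ∈ Q, X i ω := hω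
    rw [← Finset.add_sum_erase _ _ hi] at hω'
    have := h1 i hi
    exact le_trans (by linarith) (le_abs_self _)
  have hF : ∀ i ∈ Q, μ.real (F i) ≤ μ.real {ω | y ≤ X i ω} * (1 / (δ * x) ^ 2) := by
    intro i hi
    have h1 := measureReal_inter_of_notMem (μ := μ) hind hX (Finset.notMem_erase i Q)
      (measurableSet_Ici (a := y)) (D := {f | δ * x ≤ |∑ j, f j|})
      (measurableSet_le measurable_const (by fun_prop))
    rw [show μ.real (F i) = _ from h1]
    refine mul_le_mul_of_nonneg_left ?_ measureReal_nonneg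
    have h2 := measureReal_abs_sum_ge_le hind hL2 hmean (Q.erase i) (v := 1)
      (le_trans (Finset.sum_le_sum_of_subset_of_nonneg (Finset.erase_subset _ _)
        fun _ _ _ => integral_nonneg fun _ => sq_nonneg _) hv) (mul_pos hδ hx)
    refine le_trans (le_of_eq ?_) h2
    congr 1
    ext ω
    simp only [Set.mem_preimage, Set.mem_ofPred_eq]
    rw [Finset.sum_coe_sort _ (fun j => X j ω)]
  refine (measureReal_mono hsub).trans ((measureReal_union_le _ _).trans
    (add_le_add_left ((measureReal_union_le _ _).trans (add_le_add
      (measureReal_biUnion_finset_le _ _) ?_)) _))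
  rw [Finset.sum_mul]
  exact (measureReal_biUnion_finset_le _ _).trans (Finset.sum_le_sum hF)

end FiniteSums

/-! ### Exponential moments of truncated variables and the Fuk–Nagaev type bound. -/

section Exponential

lemma exp_le_of_nonpos {u : ℝ} (hu : u ≤ 0) : Real.exp u ≤ 1 + u + u ^ 2 / 2 := by
  let f : ℝ → ℝ := fun u => 1 + u + u ^ 2 / 2 - Real.exp u
  have hd : ∀ u, HasDerivAt f (1 + u - Real.exp u) u := fun u => by
    have := (((hasDerivAt_id u).const_add 1).add (((hasDerivAt_id u).pow 2).div_const 2)).sub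
      (Real.hasDerivAt_exp u)
    refine this.congr_deriv ?_
    norm_num [id]
  have hanti : Antitone f := antitone_of_deriv_nonpos (fun u => (hd u).differentiableAt)
    fun u => by rw [(hd u).deriv]; linarith [Real.add_one_le_exp u]
  have := hanti hu
  simp only [f, Real.exp_zero] at this
  linarith

/-- Divided by `exp u`, the claim says that `(1 + u) * exp (-u) + u ^ 2 / 2` is at least its value
at `0`; its derivative `u * (1 - exp (-u))` is nonnegative. -/
lemma exp_le_of_nonneg {u : ℝ} (hu : 0 ≤ u) :
    Real.exp u ≤ 1 + u + Real.exp u * (u ^ 2 / 2) := by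
  let f : ℝ → ℝ := fun u => (1 + u) * Real.exp (-u) + u ^ 2 / 2
  have hd : ∀ u, HasDerivAt f (u * (1 - Real.exp (-u))) u := fun u => by
    have := (((hasDerivAt_id u).const_add 1).mul ((hasDerivAt_neg u).exp)).add
      (((hasDerivAt_id u).pow 2).div_const 2)
    refine this.congr_deriv ?_
    norm_num [id]
    ring
  have hmono : MonotoneOn f (Set.Ici 0) := by
    refine monotoneOn_of_deriv_nonneg (convex_Ici 0)
      (fun u _ => (hd u).continuousAt.continuousWithinAt)
      (fun u _ => (hd u).differentiableAt.differentiableWithinAt) fun u h => ?_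
    rw [interior_Ici] at h
    rw [(hd u).deriv]
    exact mul_nonneg (le_of_lt h) (by simpa using le_of_lt h)
  have h1 := hmono (Set.mem_Ici.2 le_rfl) (Set.mem_Ici.2 hu) hu
  simp only [f, neg_zero, Real.exp_zero] at h1
  have h2 := mul_le_mul_of_nonneg_left h1 (Real.exp_pos u).le
  have h3 : Real.exp u * Real.exp (-u) = 1 := by rw [← Real.exp_add]; simp
  nlinarith

/-- The exponential on `(-∞, v)` is dominated by its second order expansion and a `p`-th power. -/
lemma exp_le_quadratic_add_rpow {p u v : ℝ} (hp : 0 < p) (hv : 0 < v) (huv : u ≤ v) :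
    Real.exp u ≤ 1 + u + Real.exp p * u ^ 2 / 2 + Real.exp v * v ^ (-p) * (max u 0) ^ p := by
  have hlast : 0 ≤ Real.exp v * v ^ (-p) * (max u 0) ^ p := by positivity
  rcases le_total u 0 with hu | hu
  · have := exp_le_of_nonpos hu
    have h1 : 1 ≤ Real.exp p := Real.one_le_exp hp.le
    nlinarith [sq_nonneg u]
  · rcases le_total u p with hup | hup
    · have h1 := exp_le_of_nonneg hu
      have h2 := mul_le_mul_of_nonneg_right (Real.exp_le_exp.2 hup) (by positivity : 0 ≤ u ^ 2 / 2)
      linarith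
    · have hu0 : 0 < u := hp.trans_le hup
      rw [max_eq_left hu]
      -- The function `exp u * u ^ (-p)` increases on `[p, ∞)`, which is why the case split is at `u
      -- = p`. In logarithms: `p * log (v / u) ≤ p * (v / u - 1) ≤ v - u`.
      have key : Real.exp u ≤ Real.exp v * v ^ (-p) * u ^ p := by
        rw [Real.rpow_def_of_pos hv, Real.rpow_def_of_pos hu0, ← Real.exp_add, ← Real.exp_add]
        apply Real.exp_le_exp.2
        have hlog := Real.log_le_sub_one_of_pos (div_pos hv hu0)
        rw [Real.log_div hv.ne' hu0.ne'] at hlog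
        have h3 : p * (v / u - 1) ≤ v - u := by
          rw [show v / u - 1 = (v - u) / u by field_simp, mul_div_assoc', div_le_iff₀ hu0]
          nlinarith
        nlinarith [mul_le_mul_of_nonneg_left hlog hp.le]
      have : 0 ≤ Real.exp p * u ^ 2 / 2 := by positivity
      linarith

variable {Ω ι : Type*} [MeasurableSpace Ω] {μ : Measure Ω} [IsProbabilityMeasure μ]

/-- A bound for the exponential moment of a random variable truncated from above. -/
lemma integral_indicator_exp_le {Z : Ω → ℝ} (hZ : Measurable Z) (hL2 : MemLp Z 2 μ)
    (hmean : ∫ ω, Z ω ∂μ = 0) {p M : ℝ} (hp : 0 < p)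
    (hint : Integrable (fun ω => (max (Z ω) 0) ^ p) μ) (hM : ∫ ω, (max (Z ω) 0) ^ p ∂μ ≤ M)
    {s y : ℝ} (hs : 0 < s) (hy : 0 < y) :
    ∫ ω, {ω | Z ω < y}.indicator (fun ω => Real.exp (s * Z ω)) ω ∂μ ≤
      Real.exp (Real.exp p * s ^ 2 / 2 * ∫ ω, (Z ω) ^ 2 ∂μ +
        Real.exp (s * y) * y ^ (-p) * M) := by
  have hB : MeasurableSet {ω | Z ω < y} := measurableSet_lt hZ measurable_const
  have hZi : Integrable Z μ := hL2.integrable (by norm_num)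
  have hZ2 : Integrable (fun ω => (Z ω) ^ 2) μ := hL2.integrable_sq
  have hpt : ∀ ω, {ω | Z ω < y}.indicator (fun ω => Real.exp (s * Z ω)) ω ≤
      1 + s * Z ω + Real.exp p * s ^ 2 / 2 * (Z ω) ^ 2 +
        Real.exp (s * y) * y ^ (-p) * (max (Z ω) 0) ^ p := by
    intro ω
    -- Passing to `min (Z ω) y` makes the pointwise bound applicable everywhere. Its linear term may
    -- then be raised to `s * Z ω`, which has mean zero.
    have h1 : {ω | Z ω < y}.indicator (fun ω => Real.exp (s * Z ω)) ω ≤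
        Real.exp (s * min (Z ω) y) := by
      by_cases h : Z ω < y
      · rw [Set.indicator_of_mem (by exact h), min_eq_left h.le]
      · rw [Set.indicator_of_notMem (by exact h)]
        positivity
    have h2 := exp_le_quadratic_add_rpow hp (mul_pos hs hy)
      (mul_le_mul_of_nonneg_left (min_le_right (Z ω) y) hs.le)
    have h3 : s * min (Z ω) y ≤ s * Z ω := mul_le_mul_of_nonneg_left (min_le_left _ _) hs.le
    have h4 : (min (Z ω) y) ^ 2 ≤ (Z ω) ^ 2 := by
      rcases le_total (Z ω) y with h | h
      · rw [min_eq_left h]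
      · rw [min_eq_right h]
        exact pow_le_pow_left₀ hy.le h 2
    have h5 : (s * y) ^ (-p) * (max (s * min (Z ω) y) 0) ^ p ≤ y ^ (-p) * (max (Z ω) 0) ^ p := by
      have : max (s * min (Z ω) y) 0 = s * max (min (Z ω) y) 0 := by
        rw [mul_max_of_nonneg _ _ hs.le, mul_zero]
      rw [this, Real.mul_rpow hs.le hy.le, Real.mul_rpow hs.le (le_max_right _ _),
        show s ^ (-p) * y ^ (-p) * (s ^ p * max (min (Z ω) y) 0 ^ p) =
          (s ^ (-p) * s ^ p) * (y ^ (-p) * max (min (Z ω) y) 0 ^ p) by ring,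
        ← Real.rpow_add hs, neg_add_cancel, Real.rpow_zero, one_mul]
      gcongr
      exact min_le_left _ _
    have h6 := mul_le_mul_of_nonneg_left h5 (Real.exp_pos (s * y)).le
    have h7 := mul_le_mul_of_nonneg_left h4 (by positivity : 0 ≤ Real.exp p * s ^ 2 / 2)
    refine (h1.trans h2).trans ?_
    rw [mul_pow]
    linarith
  have hi1 : Integrable (fun ω => 1 + s * Z ω) μ := (integrable_const 1).add (hZi.const_mul s)
  have hi2 := hZ2.const_mul (Real.exp p * s ^ 2 / 2)
  have hi3 := hint.const_mul (Real.exp (s * y) * y ^ (-p))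
  have hle : ∫ ω, {ω | Z ω < y}.indicator (fun ω => Real.exp (s * Z ω)) ω ∂μ ≤
      1 + (Real.exp p * s ^ 2 / 2 * ∫ ω, (Z ω) ^ 2 ∂μ +
        Real.exp (s * y) * y ^ (-p) * M) := by
    refine (integral_mono_of_nonneg (Eventually.of_forall fun ω => ?_) ((hi1.add hi2).add hi3)
      (Eventually.of_forall hpt)).trans ?_
    · exact Set.indicator_nonneg (fun _ _ => (Real.exp_pos _).le) ω
    · have e1 : ∫ ω, (1 + s * Z ω) ∂μ = 1 := by
        rw [integral_add (integrable_const 1) (hZi.const_mul s), integral_const_mul, hmean]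
        simp
      have e : ∫ ω, ((1 + s * Z ω) + Real.exp p * s ^ 2 / 2 * (Z ω) ^ 2 +
          Real.exp (s * y) * y ^ (-p) * (max (Z ω) 0) ^ p) ∂μ =
          1 + Real.exp p * s ^ 2 / 2 * ∫ ω, (Z ω) ^ 2 ∂μ +
          Real.exp (s * y) * y ^ (-p) * ∫ ω, (max (Z ω) 0) ^ p ∂μ := by
        rw [integral_add (by exact hi1.add hi2) hi3, integral_add hi1 hi2, e1, integral_const_mul,
          integral_const_mul]
      refine (le_of_eq e).trans ?_
      have : Real.exp (s * y) * y ^ (-p) * ∫ ω, (max (Z ω) 0) ^ p ∂μ ≤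
        Real.exp (s * y) * y ^ (-p) * M := by gcongr
      linarith
  refine hle.trans ?_
  rw [add_comm]
  exact Real.add_one_le_exp _

/-- A Fuk–Nagaev type bound for sums of independent random variables truncated from above. -/
lemma measureReal_sum_ge_and_lt_le {X : ι → Ω → ℝ} (hind : iIndepFun X μ)
    (hX : ∀ i, Measurable (X i))
    (hL2 : ∀ i, MemLp (X i) 2 μ) (hmean : ∀ i, ∫ ω, X i ω ∂μ = 0) {p : ℝ} (hp : 0 < p)
    (hint : ∀ i, Integrable (fun ω => (max (X i ω) 0) ^ p) μ) {m : ι → ℝ}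
    (hm : ∀ i, ∫ ω, (max (X i ω) 0) ^ p ∂μ ≤ m i)
    (Q : Finset ι) (hv : ∑ i ∈ Q, ∫ ω, (X i ω) ^ 2 ∂μ ≤ 1) (x : ℝ)
    {s y : ℝ} (hs : 0 < s) (hy : 0 < y) :
    μ.real {ω | x ≤ ∑ i ∈ Q, X i ω ∧ ∀ i ∈ Q, X i ω < y} ≤
      Real.exp (-(s * x) + Real.exp p * s ^ 2 / 2 +
        Real.exp (s * y) * y ^ (-p) * ∑ i ∈ Q, m i) := by
  classical
  -- The truncation sits inside each factor: `∏ g (X i)` is `exp (s * ∑ X i)` when all summands are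
  -- below `y` and `0` otherwise. Its mean factorises by independence, and Markov's inequality
  -- applies.
  let g : ℝ → ℝ := (Set.Iio y).indicator fun z => Real.exp (s * z)
  have hg : Measurable g := (by fun_prop : Measurable fun z => Real.exp (s * z)).indicator
    measurableSet_Iio
  have hg0 : ∀ z, 0 ≤ g z := fun z => Set.indicator_nonneg (fun _ _ => (Real.exp_pos _).le) z
  have hgb : ∀ z, g z ≤ Real.exp (s * y) := by
    intro z
    by_cases h : z < y
    · simp only [g]
      rw [Set.indicator_of_mem (by exact h)]
      gcongr
    · simp only [g]
      rw [Set.indicator_of_notMem (by exact h)]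
      positivity
  have hprod : ∫ ω, ∏ i : Q, g (X i ω) ∂μ = ∏ i : Q, ∫ ω, g (X i ω) ∂μ :=
    ((hind.precomp (g := ((↑) : Q → ι)) Subtype.val_injective).comp (fun _ => g)
      fun _ => hg).integral_fun_prod_eq_prod_integral
      fun i => (hg.comp (hX i)).aestronglyMeasurable
  have hfac : ∀ i, ∫ ω, g (X i ω) ∂μ ≤ Real.exp (Real.exp p * s ^ 2 / 2 * ∫ ω, (X i ω) ^ 2 ∂μ +
        Real.exp (s * y) * y ^ (-p) * m i) := fun i =>
    integral_indicator_exp_le (hX i) (hL2 i) (hmean i) hp (hint i) (hm i) hs hy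
  have hbound : ∫ ω, ∏ i : Q, g (X i ω) ∂μ ≤
      Real.exp (Real.exp p * s ^ 2 / 2 + Real.exp (s * y) * y ^ (-p) * ∑ i ∈ Q, m i) := by
    rw [hprod]
    refine (Finset.prod_le_prod (fun i _ => integral_nonneg fun ω => hg0 _)
      fun (i : Q) _ => hfac i).trans ?_
    rw [← Real.exp_sum, Finset.sum_coe_sort Q (fun i => Real.exp p * s ^ 2 / 2 *
      ∫ ω, (X i ω) ^ 2 ∂μ + Real.exp (s * y) * y ^ (-p) * m i), Finset.sum_add_distrib,
      ← Finset.mul_sum, ← Finset.mul_sum]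
    apply Real.exp_le_exp.2
    have : Real.exp p * s ^ 2 / 2 * ∑ i ∈ Q, ∫ ω, (X i ω) ^ 2 ∂μ ≤ Real.exp p * s ^ 2 / 2 * 1 :=
      mul_le_mul_of_nonneg_left hv (by positivity)
    linarith
  have hmeas : Measurable fun ω => ∏ i : Q, g (X i ω) :=
    Finset.measurable_prod _ fun i _ => hg.comp (hX i)
  have hInt : Integrable (fun ω => ∏ i : Q, g (X i ω)) μ := by
    refine Integrable.of_bound hmeas.aestronglyMeasurable (∏ i : Q, Real.exp (s * y))
      (Eventually.of_forall fun ω => ?_)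
    rw [Real.norm_of_nonneg (Finset.prod_nonneg fun i _ => hg0 _)]
    exact Finset.prod_le_prod (fun i _ => hg0 _) fun i _ => hgb _
  have hmarkov := mul_meas_ge_le_integral_of_nonneg
    (Eventually.of_forall fun ω => Finset.prod_nonneg fun (i : Q) _ => hg0 (X i ω)) hInt
    (Real.exp (s * x))
  have hsub : {ω | x ≤ ∑ i ∈ Q, X i ω ∧ ∀ i ∈ Q, X i ω < y} ⊆
      {ω | Real.exp (s * x) ≤ ∏ i : Q, g (X i ω)} := by
    rintro ω ⟨h1, h2⟩
    have : ∏ i : Q, g (X i ω) = Real.exp (s * ∑ i ∈ Q, X i ω) := by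
      rw [Finset.prod_coe_sort Q (fun i => g (X i ω)), Finset.mul_sum, Real.exp_sum]
      exact Finset.prod_congr rfl fun i hi => Set.indicator_of_mem (show X i ω ∈ Set.Iio y from h2 i hi) _
    show Real.exp (s * x) ≤ ∏ i : Q, g (X i ω)
    rw [this]
    gcongr
  have h1 := measureReal_mono (μ := μ) hsub
  have h2 := hmarkov.trans hbound
  rw [add_assoc, Real.exp_add, Real.exp_neg, inv_mul_eq_div, le_div_iff₀ (Real.exp_pos _), mul_comm]
  exact (mul_le_mul_of_nonneg_left h1 (Real.exp_pos _).le).trans h2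

end Exponential

/-! ### Regularly varying tails: ratios, power lower bounds, moments. -/

section RegularVariation

/-- The ratio of a function with a regularly varying tail at proportional arguments. -/
lemma tendsto_tail_ratio {G h : ℝ → ℝ} {t : ℝ} (hh : SlowlyVarying h)
    (hG : ∀ᶠ z in atTop, G z = h z / z ^ t) {l : ℝ} (hl : 0 < l) :
    Tendsto (fun z => G (l * z) / G z) atTop (𝓝 (l ^ (-t))) := by
  have hlt : Tendsto (fun z : ℝ => l * z) atTop atTop := tendsto_id.const_mul_atTop hl
  have h1 : Tendsto (fun z => h (l * z) / h z * l ^ (-t)) atTop (𝓝 (1 * l ^ (-t))) :=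
    (hh.tendsto_ratio l hl).mul_const _
  rw [one_mul] at h1
  refine h1.congr' ?_
  filter_upwards [hG, hlt.eventually hG, eventually_gt_atTop 0] with z hz hlz hz0
  rw [hz, hlz, Real.mul_rpow hl.le hz0.le, Real.rpow_neg hl.le]
  have := Real.rpow_pos_of_pos hl t
  have := Real.rpow_pos_of_pos hz0 t
  -- If `h z = 0`, both quotients are `0` by the convention for division by zero.
  by_cases hne : h z = 0
  · simp [hne]
  · field_simp

lemma eventually_tail_pos {G h : ℝ → ℝ} {t : ℝ} (hh : SlowlyVarying h)
    (hG : ∀ᶠ z in atTop, G z = h z / z ^ t) : ∀ᶠ z in atTop, 0 < G z := by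
  obtain ⟨A, -, hA⟩ := hh.measurable_pos
  filter_upwards [hG, eventually_ge_atTop A, eventually_gt_atTop 0] with z hz hzA hz0
  rw [hz]
  exact div_pos (hA z hzA) (Real.rpow_pos_of_pos hz0 t)

/-- A power lower bound for a monotone regularly varying tail. -/
lemma exists_rpow_le_tail {G : ℝ → ℝ} {t r : ℝ} (hanti : Antitone G)
    (hpos : ∀ᶠ z in atTop, 0 < G z)
    (hratio : Tendsto (fun z => G (2 * z) / G z) atTop (𝓝 (2 ^ (-t)))) (hr : t < r)
    (hr0 : 0 < r) :
    ∃ κ > 0, ∀ᶠ z in atTop, κ * z ^ (-r) ≤ G z := by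
  have hlt : (2 : ℝ) ^ (-r) < 2 ^ (-t) := Real.rpow_lt_rpow_of_exponent_lt (by norm_num) (by linarith)
  have hev := hratio.eventually (lt_mem_nhds hlt)
  obtain ⟨z₁, hz₁⟩ := eventually_atTop.1 (hev.and hpos)
  set z₀ := max z₁ 1
  have hz₀ : 0 < z₀ := lt_of_lt_of_le one_pos (le_max_right _ _)
  have hstep : ∀ z ≥ z₀, (2 : ℝ) ^ (-r) * G z ≤ G (2 * z) := fun z hz => by
    obtain ⟨h1, h2⟩ := hz₁ z ((le_max_left _ _).trans hz)
    exact ((lt_div_iff₀ h2).1 h1).le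
  have hiter : ∀ k : ℕ, ((2 : ℝ) ^ (-r)) ^ k * G z₀ ≤ G (2 ^ k * z₀) := by
    intro k
    induction k with
    | zero => simp
    | succ k ih =>
      have h1 := hstep (2 ^ k * z₀) (le_mul_of_one_le_left hz₀.le (one_le_pow₀ (by norm_num)))
      have h2 := mul_le_mul_of_nonneg_left ih (by positivity : (0:ℝ) ≤ 2 ^ (-r))
      rw [pow_succ', pow_succ', mul_assoc, mul_assoc]
      exact h2.trans h1
  have hG0 : 0 < G z₀ := (hz₁ z₀ (le_max_left _ _)).2
  -- For `2 ^ k * z₀ ≤ z < 2 ^ (k + 1) * z₀`, monotonicity compares `G z` with its value at the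
  -- right endpoint; the extra factor `2 ^ (-r)` pays for that last doubling.
  refine ⟨2 ^ (-r) * G z₀ * z₀ ^ r, by positivity, ?_⟩
  filter_upwards [eventually_ge_atTop z₀] with z hz
  have hz0 : 0 < z := hz₀.trans_le hz
  obtain ⟨k, hk1, hk2⟩ := exists_nat_pow_near ((one_le_div hz₀).2 hz) (by norm_num : (1 : ℝ) < 2)
  have h1 : G (2 ^ (k + 1) * z₀) ≤ G z := hanti ((div_lt_iff₀ hz₀).1 hk2).le
  have h2 := hiter (k + 1)
  have h3 : (z / z₀) ^ (-r) ≤ ((2 : ℝ) ^ (-r)) ^ k := by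
    rw [← Real.rpow_natCast, ← Real.rpow_mul (by norm_num), mul_comm (-r), Real.rpow_mul (by norm_num),
      Real.rpow_natCast]
    exact Real.rpow_le_rpow_of_nonpos (by positivity) hk1 (by linarith)
  rw [Real.div_rpow hz0.le hz₀.le, Real.rpow_neg hz₀.le, div_inv_eq_mul] at h3
  calc 2 ^ (-r) * G z₀ * z₀ ^ r * z ^ (-r) = 2 ^ (-r) * (z ^ (-r) * z₀ ^ r) * G z₀ := by ring
    _ ≤ 2 ^ (-r) * (2 ^ (-r)) ^ k * G z₀ := by gcongr
    _ = (2 ^ (-r)) ^ (k + 1) * G z₀ := by rw [pow_succ']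
    _ ≤ G z := h2.trans h1

/-- A regularly varying tail of index `t` has finite moments of every order below `t`. -/
lemma integrable_max_zero_rpow {Ω : Type*} [MeasurableSpace Ω] {μ : Measure Ω}
    [IsProbabilityMeasure μ] {Z : Ω → ℝ} (hZ : Measurable Z) {t p : ℝ}
    (hpos : ∀ᶠ z in atTop, 0 < μ.real {ω | z ≤ Z ω})
    (hratio : Tendsto (fun z => μ.real {ω | 2 * z ≤ Z ω} / μ.real {ω | z ≤ Z ω}) atTop
      (𝓝 (2 ^ (-t)))) (hp0 : 0 < p) (hpt : p < t) :
    Integrable (fun ω => (max (Z ω) 0) ^ p) μ := by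
  -- `w k` dominates the part of the moment from the dyadic layer `2 ^ k ≤ Z < 2 ^ (k + 1)`;
  -- consecutive ratios tend to `2 ^ (p - t) < 1`.
  let w : ℕ → ℝ := fun k => (2 ^ (k + 1)) ^ p * μ.real {ω | 2 ^ k ≤ Z ω}
  have hw0 : ∀ k, 0 ≤ w k := fun k => by positivity
  have h2k : Tendsto (fun k : ℕ => (2 : ℝ) ^ k) atTop atTop :=
    tendsto_pow_atTop_atTop_of_one_lt (by norm_num)
  have hsum : Summable w := by
    refine summable_of_ratio_test_tendsto_lt_one (l := 2 ^ p * 2 ^ (-t)) ?_ ?_ ?_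
    · rw [← Real.rpow_add (by norm_num)]
      exact Real.rpow_lt_one_of_one_lt_of_neg (by norm_num) (by linarith)
    · filter_upwards [h2k.eventually hpos] with k hk
      positivity
    · refine ((hratio.comp h2k).const_mul (2 ^ p)).congr' ?_
      filter_upwards [h2k.eventually hpos] with k hk
      simp only [Function.comp, w]
      rw [Real.norm_of_nonneg (by positivity), Real.norm_of_nonneg (by positivity),
        show (2 : ℝ) ^ (k + 1 + 1) = 2 * 2 ^ (k + 1) by ring,
        Real.mul_rpow (by norm_num) (by positivity), show (2 : ℝ) ^ (k + 1) = 2 * 2 ^ k by ring]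
      have : 0 < ((2 : ℝ) * 2 ^ k) ^ p := by positivity
      field_simp
  have hmeas : ∀ k : ℕ, MeasurableSet {ω | (2 : ℝ) ^ k ≤ Z ω} := fun k =>
    measurableSet_le measurable_const hZ
  have hpt : ∀ ω, ENNReal.ofReal ((max (Z ω) 0) ^ p) ≤
      1 + ∑' k : ℕ, {ω | (2 : ℝ) ^ k ≤ Z ω}.indicator
        (fun _ => ENNReal.ofReal ((2 ^ (k + 1)) ^ p)) ω := by
    intro ω
    rcases lt_or_ge (Z ω) 1 with h1 | h1
    · refine le_trans ?_ le_self_add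
      rw [ENNReal.ofReal_le_one]
      exact Real.rpow_le_one (le_max_right _ _) (max_le h1.le zero_le_one) hp0.le
    · obtain ⟨k, hk1, hk2⟩ := exists_nat_pow_near h1 (by norm_num : (1 : ℝ) < 2)
      refine le_trans ?_ (le_add_of_nonneg_left zero_le)
      refine le_trans ?_ (ENNReal.le_tsum k)
      rw [Set.indicator_of_mem (by exact hk1), max_eq_left (zero_le_one.trans h1)]
      exact ENNReal.ofReal_le_ofReal (Real.rpow_le_rpow (zero_le_one.trans h1) hk2.le hp0.le)
  have hfin : ∫⁻ ω, ENNReal.ofReal ((max (Z ω) 0) ^ p) ∂μ < ⊤ := by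
    refine (lintegral_mono hpt).trans_lt ?_
    rw [lintegral_add_left measurable_const, lintegral_tsum fun k =>
      (measurable_const.indicator (hmeas k)).aemeasurable]
    simp only [lintegral_const, measure_univ, mul_one]
    refine ENNReal.add_lt_top.2 ⟨ENNReal.one_lt_top, ?_⟩
    have : ∀ k : ℕ, ∫⁻ ω, {ω | (2 : ℝ) ^ k ≤ Z ω}.indicator
        (fun _ => ENNReal.ofReal ((2 ^ (k + 1)) ^ p)) ω ∂μ = ENNReal.ofReal (w k) := fun k => by
      rw [lintegral_indicator (hmeas k), setLIntegral_const, ENNReal.ofReal_mul (by positivity),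
        ofReal_measureReal]
    simp only [this]
    rw [← ENNReal.ofReal_tsum_of_nonneg hw0 hsum]
    exact ENNReal.ofReal_lt_top
  refine ⟨((hZ.max measurable_const).pow_const p).aestronglyMeasurable, ?_⟩
  rw [hasFiniteIntegral_iff_ofReal (Eventually.of_forall fun ω => by positivity)]
  exact hfin

end RegularVariation

/-! ### Passage from finite to infinite sums. -/

section InfiniteSums

variable {Ω ι : Type*} [MeasurableSpace Ω] {μ : Measure Ω} [IsProbabilityMeasure μ]

lemma measureReal_ge_le_integral_sq {Z : Ω → ℝ} (hZ : MemLp Z 2 μ) {z : ℝ} (hz : 0 < z) :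
    μ.real {ω | z ≤ Z ω} ≤ (∫ ω, (Z ω) ^ 2 ∂μ) / z ^ 2 := by
  have h := mul_meas_ge_le_integral_of_nonneg (Eventually.of_forall fun ω => sq_nonneg (Z ω))
    hZ.integrable_sq (z ^ 2)
  have hsub : {ω | z ≤ Z ω} ⊆ {ω | z ^ 2 ≤ (Z ω) ^ 2} := fun ω hω =>
    pow_le_pow_left₀ hz.le hω 2
  rw [le_div_iff₀ (by positivity), mul_comm]
  exact (mul_le_mul_of_nonneg_left (measureReal_mono hsub) (by positivity)).trans h

lemma summable_measureReal_ge {X : ι → Ω → ℝ} (hL2 : ∀ i, MemLp (X i) 2 μ)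
    (hsum : Summable fun i => ∫ ω, (X i ω) ^ 2 ∂μ) {z : ℝ} (hz : 0 < z) :
    Summable fun i => μ.real {ω | z ≤ X i ω} :=
  (hsum.div_const _).of_nonneg_of_le (fun _ => measureReal_nonneg)
    fun i => measureReal_ge_le_integral_sq (hL2 i) hz

/-- Chebyshev termwise. It makes the correction `W` in the lower bound vanish as the threshold
grows. -/
lemma tsum_measureReal_ge_le {X : ι → Ω → ℝ} (hL2 : ∀ i, MemLp (X i) 2 μ)
    (hsum : HasSum (fun i => ∫ ω, (X i ω) ^ 2 ∂μ) 1) {z : ℝ} (hz : 0 < z) :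
    ∑' i, μ.real {ω | z ≤ X i ω} ≤ 1 / z ^ 2 :=
  (summable_measureReal_ge hL2 hsum.summable hz).tsum_le_of_sum_le fun Q =>
    (Finset.sum_le_sum fun i _ => measureReal_ge_le_integral_sq (hL2 i) hz).trans <| by
      rw [← Finset.sum_div]
      gcongr
      exact sum_le_hasSum Q (fun i _ => integral_nonneg fun _ => sq_nonneg _) hsum

/-- The slack `d` absorbs the difference of the two variables. Used in both directions between a
finite partial sum and its limit in probability. -/
lemma measureReal_ge_le_add {S T : Ω → ℝ} {x y d : ℝ} (h : y + d ≤ x) :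
    μ.real {ω | x ≤ S ω} ≤ μ.real {ω | y ≤ T ω} + μ.real {ω | d ≤ |T ω - S ω|} := by
  refine (measureReal_mono fun ω hω => ?_).trans (measureReal_union_le _ _)
  by_contra hcon
  simp only [Set.mem_union, Set.mem_ofPred_eq, not_or, not_le] at hcon hω
  have := (abs_lt.1 hcon.2).1
  linarith

/-- Lower tail bound for an infinite sum of independent centred random variables. -/
lemma le_measureReal_tsum_ge {X : ι → Ω → ℝ} (hind : iIndepFun X μ)
    (hX : ∀ i, Measurable (X i))
    (hL2 : ∀ i, MemLp (X i) 2 μ) (hmean : ∀ i, ∫ ω, X i ω ∂μ = 0)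
    (hsum : HasSum (fun i => ∫ ω, (X i ω) ^ 2 ∂μ) 1) {S : Ω → ℝ}
    (hS : ∀ ε > 0, Tendsto (fun Q : Finset ι => μ.real {ω | ε ≤ |∑ i ∈ Q, X i ω - S ω|})
      atTop (𝓝 0))
    {x δ : ℝ} (hx : 0 < x) (hδ : 0 < δ) :
    (∑' i, μ.real {ω | (1 + δ) * ((1 + δ) * x) ≤ X i ω}) *
      (1 - 1 / (δ * ((1 + δ) * x)) ^ 2 - ∑' i, μ.real {ω | (1 + δ) * ((1 + δ) * x) ≤ X i ω}) ≤
      μ.real {ω | x ≤ S ω} := by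
  have hx' : 0 < (1 + δ) * x := by positivity
  have hW : Tendsto (fun Q : Finset ι => ∑ i ∈ Q, μ.real {ω | (1 + δ) * ((1 + δ) * x) ≤ X i ω})
      atTop (𝓝 (∑' i, μ.real {ω | (1 + δ) * ((1 + δ) * x) ≤ X i ω})) :=
    (summable_measureReal_ge hL2 hsum.summable (by positivity)).hasSum
  have h1 := (hW.mul (hW.const_sub (1 - 1 / (δ * ((1 + δ) * x)) ^ 2)))
  have h2 := (hS (δ * x) (by positivity)).const_add (μ.real {ω | x ≤ S ω})
  rw [add_zero] at h2
  refine le_of_tendsto_of_tendsto' h1 h2 fun Q => ?_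
  refine (le_measureReal_sum_ge hind hX hL2 hmean Q (sum_le_hasSum Q
    (fun i _ => integral_nonneg fun _ => sq_nonneg _) hsum) hx' hδ).trans ?_
  refine (measureReal_ge_le_add (T := S) (y := x) (d := δ * x) (by linarith)).trans (le_of_eq ?_)
  simp only [abs_sub_comm]

/-- Upper tail bound for an infinite sum of independent centred random variables. -/
lemma measureReal_tsum_ge_le {X : ι → Ω → ℝ} (hind : iIndepFun X μ)
    (hX : ∀ i, Measurable (X i))
    (hL2 : ∀ i, MemLp (X i) 2 μ) (hmean : ∀ i, ∫ ω, X i ω ∂μ = 0)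
    (hsum : HasSum (fun i => ∫ ω, (X i ω) ^ 2 ∂μ) 1) {S : Ω → ℝ}
    (hS : ∀ ε > 0, Tendsto (fun Q : Finset ι => μ.real {ω | ε ≤ |∑ i ∈ Q, X i ω - S ω|})
      atTop (𝓝 0)) {p : ℝ} (hp : 0 < p)
    (hint : ∀ i, Integrable (fun ω => (max (X i ω) 0) ^ p) μ) {m : ι → ℝ} (hms : Summable m)
    (hm : ∀ i, ∫ ω, (max (X i ω) 0) ^ p ∂μ ≤ m i)
    {x δ s y : ℝ} (hx : 0 < x) (hδ : 0 < δ) (hδ1 : δ < 1) (hs : 0 < s) (hy : 0 < y) :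
    μ.real {ω | x ≤ S ω} ≤ ∑' i, μ.real {ω | (1 - δ) * ((1 - δ) * x) ≤ X i ω} +
      (∑' i, μ.real {ω | y ≤ X i ω}) * (1 / (δ * ((1 - δ) * x)) ^ 2) +
      Real.exp (-(s * ((1 - δ) * x)) + Real.exp p * s ^ 2 / 2 +
        Real.exp (s * y) * y ^ (-p) * ∑' i, m i) := by
  have hδ' : 0 < 1 - δ := by linarith
  have hx' : 0 < (1 - δ) * x := by positivity
  have h2 := (hS (δ * x) (by positivity)).const_add
    (∑' i, μ.real {ω | (1 - δ) * ((1 - δ) * x) ≤ X i ω} +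
      (∑' i, μ.real {ω | y ≤ X i ω}) * (1 / (δ * ((1 - δ) * x)) ^ 2) +
      Real.exp (-(s * ((1 - δ) * x)) + Real.exp p * s ^ 2 / 2 +
        Real.exp (s * y) * y ^ (-p) * ∑' i, m i))
  rw [add_zero] at h2
  refine ge_of_tendsto' h2 fun Q => ?_
  refine (measureReal_ge_le_add (T := fun ω => ∑ i ∈ Q, X i ω) (y := (1 - δ) * x) (d := δ * x)
    (by linarith)).trans (add_le_add_left ?_ _)
  have hv := sum_le_hasSum Q (fun i _ => integral_nonneg fun ω => sq_nonneg (X i ω)) hsum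
  refine (measureReal_sum_ge_le hind hX hL2 hmean Q hv hx' hδ y).trans
    (add_le_add (add_le_add ?_ ?_) ((measureReal_sum_ge_and_lt_le hind hX hL2 hmean hp hint hm Q hv
      ((1 - δ) * x) hs hy).trans ?_))
  · exact (summable_measureReal_ge hL2 hsum.summable (by positivity)).sum_le_tsum Q
      fun _ _ => measureReal_nonneg
  · gcongr
    exact (summable_measureReal_ge hL2 hsum.summable hy).sum_le_tsum Q fun _ _ => measureReal_nonneg
  · gcongr
    exact hms.sum_le_tsum Q fun i _ => (integral_nonneg fun ω => by positivity).trans (hm i)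

end InfiniteSums

/-! ### The field as an orthogonal expansion in `L²`. -/

section SquareIntegrable

variable {Ω : Type*} [MeasurableSpace Ω] {μ : Measure Ω}

/-- Centring and independence kill the mixed products. Convergence of the field and its variance
then become Hilbert space statements. -/
lemma orthonormal_toLp {ι : Type*} [IsProbabilityMeasure μ] {ξ : ι → Ω → ℝ}
    (hindep : iIndepFun ξ μ) (hL2 : ∀ q, MemLp (ξ q) 2 μ) (hmean : ∀ q, ∫ ω, ξ q ω ∂μ = 0)
    (hvar : ∀ q, ∫ ω, (ξ q ω) ^ 2 ∂μ = 1) :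
    Orthonormal ℝ fun q => (hL2 q).toLp (ξ q) := by
  classical
  rw [orthonormal_iff_ite]
  intro i j
  have h : inner ℝ ((hL2 i).toLp (ξ i)) ((hL2 j).toLp (ξ j)) = ∫ ω, ξ i ω * ξ j ω ∂μ := by
    rw [L2.inner_def]
    refine integral_congr_ae ?_
    filter_upwards [(hL2 i).coeFn_toLp, (hL2 j).coeFn_toLp] with ω h1 h2
    rw [h1, h2]
    simp [mul_comm]
  rw [h]
  split_ifs with hij
  · subst hij
    simpa [sq] using hvar i
  · rw [(hindep.indepFun hij).integral_fun_mul_eq_mul_integral (hL2 i).1 (hL2 j).1, hmean i,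
      zero_mul]

lemma coeFn_sum_smul_toLp {ι : Type*} {f : ι → Ω → ℝ} (hf : ∀ i, MemLp (f i) 2 μ) (c : ι → ℝ)
    (Q : Finset ι) :
    (∑ i ∈ Q, c i • (hf i).toLp (f i) : Lp ℝ 2 μ) =ᵐ[μ] fun ω => ∑ i ∈ Q, c i * f i ω := by
  classical
  induction Q using Finset.induction_on with
  | empty =>
    simp only [Finset.sum_empty]
    exact Lp.coeFn_zero ℝ 2 μ
  | insert i Q hi ih =>
    simp only [Finset.sum_insert hi]
    filter_upwards [Lp.coeFn_add (c i • (hf i).toLp (f i)) (∑ i ∈ Q, c i • (hf i).toLp (f i)),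
      Lp.coeFn_smul (c i) ((hf i).toLp (f i)), (hf i).coeFn_toLp, ih] with ω h1 h2 h3 h4
    rw [h1, Pi.add_apply, h2, h4, Pi.smul_apply, h3, smul_eq_mul]

variable {ξ : ℤ × ℤ → Ω → ℝ} (hL2 : ∀ q, MemLp (ξ q) 2 μ)
  (horth : Orthonormal ℝ fun q => (hL2 q).toLp (ξ q))
include horth

/-- The partial sums of the field expand in the innovations with coefficients `coeff a G`. -/
lemma exists_hasSum_coeff_smul {a : ℤ × ℤ → ℝ} (ha : Summable fun q => (a q) ^ 2)
    (G : Finset (ℤ × ℤ)) :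
    ∃ F : Lp ℝ 2 μ, HasSum (fun q => coeff a G q • (hL2 (-q)).toLp (ξ (-q))) F ∧
      partialSum μ a ξ G =ᵐ[μ] F := by
  classical
  let e : ℤ × ℤ → Lp ℝ 2 μ := fun q => (hL2 q).toLp (ξ q)
  let f : ℤ × ℤ → Lp ℝ 2 μ := fun p => ∑' q, a q • e (p - q)
  -- The shift `q ↦ p + q` indexes every site's series by the same innovations `e (-q)`, so summing
  -- over `p ∈ G` collects the coefficients `coeff a G q`.
  have hf : ∀ p, HasSum (fun q => a (p + q) • e (-q)) (f p) := by
    intro p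
    have horth' : Orthonormal ℝ fun q => e (p - q) :=
      horth.comp (fun q => p - q) fun _ _ h => by simpa using h
    have hs : Summable fun q => a q • e (p - q) := by
      have := horth'.orthogonalFamily.summable_iff_norm_sq_summable a
      simp only [LinearIsometry.toSpanSingleton_apply, Real.norm_eq_abs, sq_abs] at this
      exact this.2 ha
    have h1 := (Equiv.addLeft p).hasSum_iff.2 hs.hasSum
    simpa [Function.comp_def] using h1
  have hfield : ∀ p, field μ a ξ p = f p := by
    intro p
    have : ∀ q, MemLp (fun ω => a q * ξ (p - q) ω) 2 μ := fun q => (hL2 (p - q)).const_mul (a q)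
    simp only [field, l2Sum, f, e]
    congr 1
    congr 1
    refine tsum_congr fun q => ?_
    rw [dif_pos (this q)]
    rfl
  refine ⟨∑ p ∈ G, f p, ?_, ?_⟩
  · have h := hasSum_sum fun p (_ : p ∈ G) => hf p
    simpa only [coeff, Finset.sum_smul] using h
  · filter_upwards [Lp.coeFn_finsetSum G f] with ω hω
    rw [hω, Finset.sum_apply]
    simp only [partialSum, hfield]

/-- The variance of a partial sum of the field is the sum of its squared coefficients. -/
lemma hasSum_coeff_sq {a : ℤ × ℤ → ℝ} (ha : Summable fun q => (a q) ^ 2)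
    (G : Finset (ℤ × ℤ)) :
    HasSum (fun q => (coeff a G q) ^ 2) ((sigma μ a ξ G) ^ 2) := by
  obtain ⟨F, hF, hS⟩ := exists_hasSum_coeff_smul hL2 horth ha G
  have h1 : (sigma μ a ξ G) ^ 2 = ‖F‖ ^ 2 := by
    rw [sigma, Real.sq_sqrt (integral_nonneg fun _ => sq_nonneg _), ← real_inner_self_eq_norm_sq,
      L2.inner_def]
    refine integral_congr_ae ?_
    filter_upwards [hS] with ω hω
    rw [hω]
    simp [sq]
  rw [h1]
  have horth' : Orthonormal ℝ fun q => (hL2 (-q)).toLp (ξ (-q)) :=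
    horth.comp (fun q => -q) neg_injective
  have h2 : Tendsto (fun Q : Finset (ℤ × ℤ) =>
      ‖∑ q ∈ Q, coeff a G q • (hL2 (-q)).toLp (ξ (-q))‖ ^ 2) atTop (𝓝 (‖F‖ ^ 2)) :=
    (hF.norm.pow 2)
  refine h2.congr fun Q => ?_
  have := horth'.orthogonalFamily.norm_sum (coeff a G) Q
  simpa only [LinearIsometry.toSpanSingleton_apply, Real.norm_eq_abs, sq_abs] using this

/-- The partial sums of the field are limits in probability of finite linear combinations. -/
lemma tendsto_measureReal_sum_coeff [IsFiniteMeasure μ] {a : ℤ × ℤ → ℝ}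
    (ha : Summable fun q => (a q) ^ 2) (G : Finset (ℤ × ℤ)) {ε : ℝ} (hε : 0 < ε) :
    Tendsto (fun Q : Finset (ℤ × ℤ) =>
      μ.real {ω | ε ≤ |∑ q ∈ Q, coeff a G q * ξ (-q) ω - partialSum μ a ξ G ω|}) atTop (𝓝 0) := by
  obtain ⟨F, hF, hS⟩ := exists_hasSum_coeff_smul hL2 horth ha G
  have h0 := tendstoInMeasure_of_tendsto_Lp (show Tendsto (fun Q : Finset (ℤ × ℤ) =>
    ∑ q ∈ Q, coeff a G q • (hL2 (-q)).toLp (ξ (-q))) atTop (𝓝 F) from hF)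
  rw [tendstoInMeasure_iff_measureReal_norm] at h0
  have h := h0 ε hε
  refine h.congr fun Q => measureReal_congr (eventuallyEq_set.2 ?_)
  filter_upwards [coeFn_sum_smul_toLp (fun q => hL2 (-q)) (coeff a G) Q, hS] with ω h1 h2
  simp only [h1, h2, Real.norm_eq_abs]

end SquareIntegrable

/-! ### Asymptotics of tail sums and deterministic estimates for the error term. -/

section Asymptotics

variable {ι : Type*}

/-- Termwise regular variation passes to sums whose arguments tend to infinity uniformly. -/
lemma tendsto_tsum_ratio {G : ℝ → ℝ} {l L : ℝ} (hL : Tendsto (fun z => G (l * z) / G z) atTop (𝓝 L))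
    (hpos : ∀ᶠ z in atTop, 0 < G z) {T : ℕ → ι → ℝ} (hT : ∀ Z, ∀ᶠ n in atTop, ∀ i, Z ≤ T n i)
    (hs : ∀ᶠ n in atTop, Summable fun i => G (T n i))
    (hsl : ∀ᶠ n in atTop, Summable fun i => G (l * T n i))
    (hV : ∀ᶠ n in atTop, 0 < ∑' i, G (T n i)) :
    Tendsto (fun n => (∑' i, G (l * T n i)) / ∑' i, G (T n i)) atTop (𝓝 L) := by
  rw [Metric.tendsto_nhds]
  intro ε hε
  obtain ⟨Z, hZ⟩ := eventually_atTop.1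
    ((hL.eventually (Metric.ball_mem_nhds L (half_pos hε))).and hpos)
  filter_upwards [hT Z, hs, hsl, hV] with n hn hs hsl hV
  have hb : ∀ i, (L - ε / 2) * G (T n i) ≤ G (l * T n i) ∧
      G (l * T n i) ≤ (L + ε / 2) * G (T n i) := by
    intro i
    obtain ⟨h1, h2⟩ := hZ _ (hn i)
    rw [Real.dist_eq, abs_lt] at h1
    constructor
    · rw [← le_div_iff₀ h2]; linarith
    · rw [← div_le_iff₀ h2]; linarith
  have h1 : (L - ε / 2) * ∑' i, G (T n i) ≤ ∑' i, G (l * T n i) := by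
    rw [← tsum_mul_left]
    exact (hs.mul_left _).tsum_le_tsum (fun i => (hb i).1) hsl
  have h2 : ∑' i, G (l * T n i) ≤ (L + ε / 2) * ∑' i, G (T n i) := by
    rw [← tsum_mul_left]
    exact hsl.tsum_le_tsum (fun i => (hb i).2) (hs.mul_left _)
  rw [← le_div_iff₀ hV] at h1
  rw [← div_le_iff₀ hV] at h2
  rw [Real.dist_eq, abs_lt]
  constructor <;> linarith

/-- A squeeze in two stages: `δ` is fixed first, using only the limits of the bounds in `n`, so no
uniformity in `δ` is needed. -/
lemma tendsto_of_bounds {R : ℕ → ℝ} {u l : ℝ → ℕ → ℝ} {U L : ℝ → ℝ} {r : ℝ}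
    (hl : ∀ᶠ δ in 𝓝[>] (0 : ℝ), ∀ᶠ n in atTop, l δ n ≤ R n)
    (hu : ∀ᶠ δ in 𝓝[>] (0 : ℝ), ∀ᶠ n in atTop, R n ≤ u δ n)
    (hlL : ∀ᶠ δ in 𝓝[>] (0 : ℝ), Tendsto (l δ) atTop (𝓝 (L δ)))
    (huU : ∀ᶠ δ in 𝓝[>] (0 : ℝ), Tendsto (u δ) atTop (𝓝 (U δ)))
    (hL : Tendsto L (𝓝[>] 0) (𝓝 r)) (hU : Tendsto U (𝓝[>] 0) (𝓝 r)) :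
    Tendsto R atTop (𝓝 r) := by
  refine tendsto_order.2 ⟨fun a ha => ?_, fun a ha => ?_⟩
  · obtain ⟨δ, h1, h2, h3⟩ := (hl.and (hlL.and (hL.eventually (lt_mem_nhds ha)))).exists
    filter_upwards [h1, h2.eventually (lt_mem_nhds h3)] with n h4 h5 using h5.trans_le h4
  · obtain ⟨δ, h1, h2, h3⟩ := (hu.and (huU.and (hU.eventually (gt_mem_nhds ha)))).exists
    filter_upwards [h1, h2.eventually (gt_mem_nhds h3)] with n h4 h5 using h4.trans_lt h5

lemma le_one_of_hasSum_sq {c : ι → ℝ} (hc : HasSum (fun i => (c i) ^ 2) 1) (i : ι) : c i ≤ 1 := by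
  have := le_hasSum hc i fun _ _ => sq_nonneg _
  exact (sq_le_one_iff_abs_le_one _).1 this |>.trans' (le_abs_self _)

lemma rpow_le_sq_of_hasSum_sq {c : ι → ℝ} (hc0 : ∀ i, 0 < c i)
    (hc : HasSum (fun i => (c i) ^ 2) 1) {p : ℝ} (hp : 2 ≤ p) (i : ι) : (c i) ^ p ≤ (c i) ^ 2 := by
  rw [← Real.rpow_two]
  exact Real.rpow_le_rpow_of_exponent_ge (hc0 i) (le_one_of_hasSum_sq hc i) hp

lemma summable_rpow_of_hasSum_sq {c : ι → ℝ} (hc0 : ∀ i, 0 < c i)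
    (hc : HasSum (fun i => (c i) ^ 2) 1) {p : ℝ} (hp : 2 ≤ p) : Summable fun i => (c i) ^ p :=
  hc.summable.of_nonneg_of_le (fun i => (Real.rpow_pos_of_pos (hc0 i) p).le)
    (rpow_le_sq_of_hasSum_sq hc0 hc hp)

/-- The truncated exponential bound, with the exponent optimised, is quadratic in
`A = ∑ (c i / x) ^ p`. -/
lemma exp_error_le {x p A B M δ L : ℝ} (hx : 0 < x) (hA : 0 < A) (hAB : A = x ^ (-p) * B)
    (hL : L = -Real.log A) (hL0 : 0 ≤ L) (hLx : 8 * Real.exp p * L ≤ x ^ 2) (hδ : δ ≤ 1 / 4) :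
    Real.exp (-(4 * L / x * ((1 - δ) * x)) + Real.exp p * (4 * L / x) ^ 2 / 2 +
      Real.exp (4 * L / x * (x / 4)) * (x / 4) ^ (-p) * (M * B)) ≤
      Real.exp (4 ^ p * M) * A ^ 2 := by
  -- With `s = 4 * L / x` and `y = x / 4`, `exp (s * y) = 1 / A` turns the moment term into the
  -- constant `4 ^ p * M`. The linear term is at most `-3 * L` because `δ ≤ 1 / 4`, and the
  -- quadratic term is at most `L`, leaving `exp (-2 * L) = A ^ 2`.
  have h1 : 4 * L / x * (x / 4) = L := by field_simp
  have h2 : Real.exp L = A⁻¹ := by rw [hL, Real.exp_neg, Real.exp_log hA]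
  have h3 : (x / 4) ^ (-p) = 4 ^ p * x ^ (-p) := by
    rw [Real.div_rpow hx.le (by norm_num), Real.rpow_neg (by norm_num : (0 : ℝ) ≤ 4), div_inv_eq_mul,
      mul_comm]
  have h4 : Real.exp (4 * L / x * (x / 4)) * (x / 4) ^ (-p) * (M * B) = 4 ^ p * M := by
    rw [h1, h2, h3, show A⁻¹ * (4 ^ p * x ^ (-p)) * (M * B) = A⁻¹ * (x ^ (-p) * B) * (4 ^ p * M) by
      ring, ← hAB, inv_mul_cancel₀ hA.ne', one_mul]
  have h5 : -(4 * L / x * ((1 - δ) * x)) ≤ -(3 * L) := by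
    rw [show 4 * L / x * ((1 - δ) * x) = 4 * L * (1 - δ) by field_simp]
    nlinarith
  have h6 : Real.exp p * (4 * L / x) ^ 2 / 2 ≤ L := by
    rw [show Real.exp p * (4 * L / x) ^ 2 / 2 = (8 * Real.exp p * L) * L / x ^ 2 by field_simp; ring,
      div_le_iff₀ (by positivity)]
    nlinarith
  have h7 : A ^ 2 = Real.exp (-2 * L) := by
    rw [hL, ← Real.exp_log (pow_pos hA 2), Real.log_pow]
    congr 1
    push_cast
    ring
  rw [h4, h7, ← Real.exp_add]
  apply Real.exp_le_exp.2
  linarith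

/-- Logarithmic size of `∑ (c i / x) ^ p` when `x` dominates `(log (1 / ∑ (c i) ^ t)) ^ (1 / 2)`. -/
lemma neg_log_sum_rpow_bounds [Nonempty ι] {c : ι → ℝ} {x p t : ℝ} (hc0 : ∀ i, 0 < c i)
    (hc : HasSum (fun i => (c i) ^ 2) 1) (hp : 2 ≤ p) (hpt : p < t) (hx1 : 1 < x)
    (hxg : 8 * Real.exp p * p / (1 - Real.exp (p - t)) ≤ x)
    (hlog : 8 * Real.exp t * Real.log (∑' i, (c i) ^ t)⁻¹ ≤ x ^ 2) :
    0 < x ^ (-p) * ∑' i, (c i) ^ p ∧ 0 < -Real.log (x ^ (-p) * ∑' i, (c i) ^ p) ∧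
      8 * Real.exp p * (-Real.log (x ^ (-p) * ∑' i, (c i) ^ p)) ≤ x ^ 2 := by
  have hx : 0 < x := by linarith
  have hgap : 0 < 1 - Real.exp (p - t) := by
    rw [sub_pos, Real.exp_lt_one_iff]
    linarith
  have hBs := summable_rpow_of_hasSum_sq hc0 hc hp
  have hts := summable_rpow_of_hasSum_sq hc0 hc (hp.trans hpt.le)
  obtain ⟨i₀⟩ := ‹Nonempty ι›
  have hUpos : 0 < ∑' i, (c i) ^ t := hts.tsum_pos
    (fun i => (Real.rpow_pos_of_pos (hc0 i) t).le) i₀ (Real.rpow_pos_of_pos (hc0 i₀) t)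
  have hUB : ∑' i, (c i) ^ t ≤ ∑' i, (c i) ^ p := hts.tsum_le_tsum (fun i =>
    Real.rpow_le_rpow_of_exponent_ge (hc0 i) (le_one_of_hasSum_sq hc i) hpt.le) hBs
  have hBpos : 0 < ∑' i, (c i) ^ p := hUpos.trans_le hUB
  have hB1 : ∑' i, (c i) ^ p ≤ 1 := by
    rw [← hc.tsum_eq]
    exact hBs.tsum_le_tsum (rpow_le_sq_of_hasSum_sq hc0 hc hp) hc.summable
  generalize ∑' i, (c i) ^ p = B at *
  generalize ∑' i, (c i) ^ t = U at *
  have hApos : 0 < x ^ (-p) * B := by positivity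
  have hA1 : x ^ (-p) * B < 1 := by
    have : x ^ (-p) < 1 := Real.rpow_lt_one_of_one_lt_of_neg hx1 (by linarith)
    exact mul_lt_one_of_nonneg_of_lt_one_left (by positivity) this hB1
  refine ⟨hApos, by linarith [Real.log_neg hApos hA1], ?_⟩
  -- The crude `log x ≤ x` suffices: `p < t` leaves the fraction `1 - exp (p - t)` of `x ^ 2` free,
  -- and the linear term fits there by `hxg`.
  have hLle : -Real.log (x ^ (-p) * B) ≤ p * x + Real.log U⁻¹ := by
    rw [Real.log_mul (by positivity) hBpos.ne', Real.log_rpow hx, Real.log_inv]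
    have h1 := mul_le_mul_of_nonneg_left (Real.log_le_self hx.le) (by linarith : 0 ≤ p)
    have h2 := Real.log_le_log hUpos hUB
    linarith
  have h1 : 8 * Real.exp p * Real.log U⁻¹ ≤ Real.exp (p - t) * x ^ 2 := by
    have := mul_le_mul_of_nonneg_left hlog (Real.exp_pos (p - t)).le
    rwa [show Real.exp (p - t) * (8 * Real.exp t * Real.log U⁻¹) =
      8 * (Real.exp (p - t) * Real.exp t) * Real.log U⁻¹ by ring,
      ← Real.exp_add, sub_add_cancel] at this
  have h2 : 8 * Real.exp p * p ≤ x * (1 - Real.exp (p - t)) := (div_le_iff₀ hgap).1 hxg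
  have h3 := mul_le_mul_of_nonneg_left hLle (by positivity : 0 ≤ 8 * Real.exp p)
  have h4 := mul_le_mul_of_nonneg_right h2 hx.le
  linarith

/-- A lower bound for the sum of the tails by the square of `∑ (c i / x) ^ p`. -/
lemma sq_mul_le_tsum_tail {G : ℝ → ℝ} {c : ι → ℝ} {x p κ : ℝ} (hc0 : ∀ i, 0 < c i)
    (hc : HasSum (fun i => (c i) ^ 2) 1) (hx : 0 < x) (hp : 2 ≤ p) (hκ : 0 < κ)
    (hG : ∀ i, κ * (x / c i) ^ (-(2 * p - 2)) ≤ G (x / c i))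
    (hs : Summable fun i => G (x / c i)) :
    κ * x ^ 2 * (x ^ (-p) * ∑' i, (c i) ^ p) ^ 2 ≤ ∑' i, G (x / c i) := by
  have hlim : Tendsto (fun Q : Finset ι => κ * x ^ 2 * (x ^ (-p) * ∑ i ∈ Q, (c i) ^ p) ^ 2) atTop
      (𝓝 (κ * x ^ 2 * (x ^ (-p) * ∑' i, (c i) ^ p) ^ 2)) :=
    (((summable_rpow_of_hasSum_sq hc0 hc hp).hasSum.const_mul _).pow 2).const_mul _
  refine le_of_tendsto' hlim fun Q => ?_
  have hGnn : ∀ i, 0 ≤ G (x / c i) := fun i => le_trans (by have := hc0 i; positivity) (hG i)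
  refine le_trans ?_ (hs.sum_le_tsum Q fun i _ => hGnn i)
  have hterm : ∀ i, (c i) ^ p = c i * (c i) ^ (p - 1) := fun i => by
    rw [Real.rpow_sub_one (hc0 i).ne']
    have := (hc0 i).ne'
    field_simp
  -- Cauchy–Schwarz for `c ^ p = c * c ^ (p - 1)`; it produces the exponent `2 * p - 2` at which `G`
  -- is bounded below.
  have h1 : (∑ i ∈ Q, (c i) ^ p) ^ 2 ≤ (∑ i ∈ Q, (c i) ^ 2) * ∑ i ∈ Q, ((c i) ^ (p - 1)) ^ 2 := by
    simp only [hterm]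
    exact Finset.sum_mul_sq_le_sq_mul_sq _ _ _
  have h2 : ∑ i ∈ Q, (c i) ^ 2 ≤ 1 := sum_le_hasSum Q (fun i _ => sq_nonneg _) hc
  have h3 : (∑ i ∈ Q, (c i) ^ p) ^ 2 ≤ ∑ i ∈ Q, ((c i) ^ (p - 1)) ^ 2 :=
    h1.trans (mul_le_of_le_one_left (Finset.sum_nonneg fun i _ => sq_nonneg _) h2)
  calc κ * x ^ 2 * (x ^ (-p) * ∑ i ∈ Q, (c i) ^ p) ^ 2
      ≤ κ * x ^ 2 * ((x ^ (-p)) ^ 2 * ∑ i ∈ Q, ((c i) ^ (p - 1)) ^ 2) := by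
        rw [mul_pow]
        gcongr
    _ = ∑ i ∈ Q, κ * (x / c i) ^ (-(2 * p - 2)) := by
        rw [Finset.mul_sum, Finset.mul_sum]
        refine Finset.sum_congr rfl fun i _ => ?_
        have hci := hc0 i
        rw [Real.div_rpow hx.le hci.le, Real.rpow_neg hci.le, div_inv_eq_mul,
          ← Real.rpow_natCast (x ^ (-p)), ← Real.rpow_natCast (c i ^ (p - 1)),
          ← Real.rpow_mul hx.le, ← Real.rpow_mul hci.le, ← Real.rpow_two,
          show (-(2 * p - 2) : ℝ) = 2 + -p * (2 : ℕ) by push_cast; ring, Real.rpow_add hx,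
          show (2 * p - 2 : ℝ) = (p - 1) * (2 : ℕ) by push_cast; ring]
        ring
    _ ≤ _ := Finset.sum_le_sum fun i _ => hG i

end Asymptotics

/-! ### The one-big-jump asymptotics for normalised weights. -/

section Core

variable {Ω ι : Type*} [MeasurableSpace Ω] {μ : Measure Ω} [IsProbabilityMeasure μ]

set_option maxHeartbeats 1000000 in
/-- Moderate and large deviations for weighted sums of i.i.d. random variables with a regularly
varying right tail. -/
theorem isEquivalent_tsum_tail [Nonempty ι] {ζ : ι → Ω → ℝ} {Z : Ω → ℝ} (hind : iIndepFun ζ μ)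
    (hζ : ∀ i, Measurable (ζ i)) (hid : ∀ i, IdentDistrib (ζ i) Z μ μ) (hZ : Measurable Z)
    (hL2 : MemLp Z 2 μ) (hmean : ∫ ω, Z ω ∂μ = 0) (hvar : ∫ ω, (Z ω) ^ 2 ∂μ = 1)
    {t : ℝ} (ht : 2 < t)
    (hpos : ∀ᶠ z in atTop, 0 < μ.real {ω | z ≤ Z ω})
    (hratio : ∀ l > 0, Tendsto (fun z => μ.real {ω | l * z ≤ Z ω} / μ.real {ω | z ≤ Z ω}) atTop
      (𝓝 (l ^ (-t))))
    {c : ℕ → ι → ℝ} (hc0 : ∀ n i, 0 < c n i) (hc : ∀ n, HasSum (fun i => (c n i) ^ 2) 1)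
    {S : ℕ → Ω → ℝ}
    (hS : ∀ n, ∀ ε > 0, Tendsto (fun Q : Finset ι =>
      μ.real {ω | ε ≤ |∑ i ∈ Q, c n i * ζ i ω - S n ω|}) atTop (𝓝 0))
    {x : ℕ → ℝ} (hx : Tendsto x atTop atTop)
    (hlog : ∀ n, 8 * Real.exp t * Real.log (∑' i, (c n i) ^ t)⁻¹ ≤ (x n) ^ 2) :
    (fun n => μ.real {ω | x n ≤ S n ω}) ~[atTop]
      (fun n => ∑' i, μ.real {ω | x n / c n i ≤ Z ω}) := by
  set G : ℝ → ℝ := fun z => μ.real {ω | z ≤ Z ω} with hGdef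
  have hanti : Antitone G := fun a b hab => measureReal_mono fun ω hω => le_trans hab hω
  have hG0 : ∀ z, 0 ≤ G z := fun z => measureReal_nonneg
  -- `p < t` makes the moment finite; `2 * p - 2 > t` permits the lower bound `κ * z ^ (-(2 * p -
  -- 2))` on the tail. The witness is the midpoint of `(t + 2) / 2` and `t`.
  obtain ⟨p, hp2, hpt, hpr⟩ : ∃ p : ℝ, 2 < p ∧ p < t ∧ t < 2 * p - 2 :=
    ⟨(3 * t + 2) / 4, by linarith, by linarith, by linarith⟩
  have hp0 : 0 < p := by linarith
  have hint : Integrable (fun ω => (max (Z ω) 0) ^ p) μ :=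
    integrable_max_zero_rpow hZ hpos (hratio 2 two_pos) hp0 hpt
  set M := ∫ ω, (max (Z ω) 0) ^ p ∂μ with hM
  obtain ⟨κ, hκ, hκG⟩ := exists_rpow_le_tail (G := G) hanti hpos (hratio 2 two_pos) hpr (by linarith)
  -- the summands
  let X : ℕ → ι → Ω → ℝ := fun n i ω => c n i * ζ i ω
  have hXind : ∀ n, iIndepFun (X n) μ := fun n =>
    hind.comp (fun i z => c n i * z) fun i => measurable_const_mul _
  have hXm : ∀ n i, Measurable (X n i) := fun n i => (hζ i).const_mul _
  have hXL2 : ∀ n i, MemLp (X n i) 2 μ := fun n i => ((hid i).symm.memLp_snd hL2 |>.const_mul _)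
  have hXmean : ∀ n i, ∫ ω, X n i ω ∂μ = 0 := fun n i => by
    simp only [X]
    rw [integral_const_mul, (hid i).integral_eq, hmean, mul_zero]
  have hXsq : ∀ n i, ∫ ω, (X n i ω) ^ 2 ∂μ = (c n i) ^ 2 := fun n i => by
    simp only [X, mul_pow]
    have h := ((hid i).comp (u := fun z : ℝ => z ^ 2) (by fun_prop)).integral_eq
    simp only [Function.comp_def] at h
    rw [integral_const_mul, h, hvar, mul_one]
  have hXsum : ∀ n, HasSum (fun i => ∫ ω, (X n i ω) ^ 2 ∂μ) 1 := fun n => by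
    simpa only [hXsq] using hc n
  have hmaxid : ∀ i, IdentDistrib (fun ω => (max (ζ i ω) 0) ^ p) (fun ω => (max (Z ω) 0) ^ p) μ μ :=
    fun i => (hid i).comp (u := fun z : ℝ => (max z 0) ^ p) (by fun_prop)
  have hXmax : ∀ n i ω, (max (X n i ω) 0) ^ p = (c n i) ^ p * (max (ζ i ω) 0) ^ p := fun n i ω => by
    rw [← Real.mul_rpow (hc0 n i).le (le_max_right _ _), mul_max_of_nonneg _ _ (hc0 n i).le, mul_zero]
  have hXint : ∀ n i, Integrable (fun ω => (max (X n i ω) 0) ^ p) μ := fun n i => by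
    simp only [hXmax]
    exact ((hmaxid i).integrable_iff.2 hint).const_mul _
  have hXM : ∀ n i, ∫ ω, (max (X n i ω) 0) ^ p ∂μ ≤ M * (c n i) ^ p := fun n i => by
    simp only [hXmax]
    rw [integral_const_mul, (hmaxid i).integral_eq, mul_comm]
  have hXG : ∀ n i z, μ.real {ω | z ≤ X n i ω} = G (z / c n i) := fun n i z => by
    have h := (hid i).measure_mem_eq (measurableSet_Ici (a := z / c n i))
    have h' : {ω | z ≤ X n i ω} = ζ i ⁻¹' Set.Ici (z / c n i) := by
      ext ω
      simp only [X, Set.mem_ofPred_eq, Set.mem_preimage, Set.mem_Ici]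
      rw [div_le_iff₀' (hc0 n i)]
    rw [h', measureReal_def, h]
    rfl
  have hGs : ∀ n, ∀ z > 0, Summable fun i => G (z / c n i) := fun n z hz => by
    simpa only [hXG] using summable_measureReal_ge (hXL2 n) (hXsum n).summable hz
  -- uniform growth of the arguments
  have hT : ∀ K, ∀ᶠ n in atTop, ∀ i, K ≤ x n / c n i := fun K => by
    filter_upwards [hx.eventually_ge_atTop (max K 0)] with n hn i
    have hx0 : 0 ≤ x n := (le_max_right _ _).trans hn
    exact ((le_max_left _ _).trans hn).trans
      (le_div_self hx0 (hc0 n i) (le_one_of_hasSum_sq (hc n) i))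
  have hxpos : ∀ᶠ n in atTop, 0 < x n := hx.eventually_gt_atTop 0
  set V : ℕ → ℝ := fun n => ∑' i, G (x n / c n i) with hV
  have hVpos : ∀ᶠ n in atTop, 0 < V n := by
    obtain ⟨K, hK⟩ := eventually_atTop.1 hpos
    filter_upwards [hT K, hxpos] with n hn hxn
    obtain ⟨i⟩ := ‹Nonempty ι›
    exact (hGs n _ hxn).tsum_pos (fun _ => hG0 _) i (hK _ (hn i))
  have hVratio : ∀ l > 0, Tendsto (fun n => (∑' i, G (l * x n / c n i)) / V n) atTop
      (𝓝 (l ^ (-t))) := fun l hl => by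
    have := tendsto_tsum_ratio (T := fun n i => x n / c n i) (hratio l hl) hpos hT
      (hxpos.mono fun n hn => hGs n _ hn)
      (hxpos.mono fun n hn => by simpa only [mul_div_assoc] using hGs n _ (mul_pos hl hn)) hVpos
    simpa only [mul_div_assoc] using this
  have hx2 : ∀ a ≠ 0, Tendsto (fun n => 1 / (a * x n) ^ 2) atTop (𝓝 0) := fun a ha => by
    have h : Tendsto (fun n => a ^ 2 * x n ^ 2) atTop atTop :=
      ((tendsto_pow_atTop two_ne_zero).comp hx).const_mul_atTop (by positivity)
    refine h.inv_tendsto_atTop.congr fun n => ?_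
    simp only [Pi.inv_apply]
    rw [mul_pow, one_div]
  -- the truncated part is negligible
  have herr : ∀ δ : ℝ, 0 < δ → δ ≤ 1 / 4 → ∀ᶠ n in atTop, μ.real {ω | x n ≤ S n ω} / V n ≤
      (∑' i, G ((1 - δ) * (1 - δ) * x n / c n i)) / V n +
      (∑' i, G (1 / 4 * x n / c n i)) / V n * (1 / (δ * (1 - δ) * x n) ^ 2) +
      Real.exp (4 ^ p * M) / κ * (1 / (1 * x n) ^ 2) := by
    intro δ hδ hδ4
    obtain ⟨K, hK⟩ := eventually_atTop.1 hκG
    filter_upwards [hT K, hxpos, hVpos, hx.eventually_gt_atTop 1,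
      hx.eventually_ge_atTop (8 * Real.exp p * p / (1 - Real.exp (p - t)))] with n hn hxn hVn hx1 hxg
    obtain ⟨hApos, hLpos, hLx⟩ := neg_log_sum_rpow_bounds (hc0 n) (hc n) hp2.le hpt hx1 hxg (hlog n)
    have hBs := summable_rpow_of_hasSum_sq (hc0 n) (hc n) hp2.le
    set B := ∑' i, (c n i) ^ p with hB
    set A := x n ^ (-p) * B with hA
    set L := -Real.log A with hL
    have hE := exp_error_le (M := M) (δ := δ) hxn hApos hA hL hLpos.le hLx hδ4
    have hlow := sq_mul_le_tsum_tail (hc0 n) (hc n) hxn hp2.le hκ (fun i => hK _ (hn i))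
      (hGs n _ hxn)
    have hup := measureReal_tsum_ge_le (hXind n) (hXm n) (hXL2 n) (hXmean n) (hXsum n) (hS n) hp0
      (hXint n) (hBs.mul_left M) (hXM n) hxn hδ (by linarith) (s := 4 * L / x n) (y := x n / 4)
      (by positivity) (by positivity)
    rw [tsum_mul_left] at hup
    simp only [hXG] at hup
    -- The factor `x n ^ 2` in `V n ≥ κ * x n ^ 2 * A ^ 2` is what makes the truncated part
    -- negligible relative to `V n`.
    have hE' : Real.exp (4 ^ p * M) * A ^ 2 ≤ V n * (Real.exp (4 ^ p * M) / κ * (1 / (1 * x n) ^ 2)) := by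
      rw [one_mul, show V n * (Real.exp (4 ^ p * M) / κ * (1 / x n ^ 2)) =
        Real.exp (4 ^ p * M) * (V n / (κ * x n ^ 2)) by field_simp]
      refine mul_le_mul_of_nonneg_left ?_ (Real.exp_pos _).le
      rw [le_div_iff₀ (by positivity), mul_comm]
      exact hlow
    rw [div_le_iff₀ hVn]
    refine (hup.trans (add_le_add_right (hE.trans hE') _)).trans (le_of_eq ?_)
    rw [show x n / 4 = 1 / 4 * x n by ring, show (1 - δ) * ((1 - δ) * x n) = (1 - δ) * (1 - δ) * x n by
      ring, show δ * ((1 - δ) * x n) = δ * (1 - δ) * x n by ring]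
    field_simp
  have hlower : ∀ δ : ℝ, 0 < δ → ∀ᶠ n in atTop,
      (∑' i, G ((1 + δ) * (1 + δ) * x n / c n i)) / V n * (1 - 1 / (δ * (1 + δ) * x n) ^ 2 -
        1 / ((1 + δ) * (1 + δ) * x n) ^ 2) ≤ μ.real {ω | x n ≤ S n ω} / V n := by
    intro δ hδ
    filter_upwards [hxpos, hVpos] with n hxn hVn
    have h1 := le_measureReal_tsum_ge (hXind n) (hXm n) (hXL2 n) (hXmean n) (hXsum n) (hS n) hxn hδ
    have h2 := tsum_measureReal_ge_le (hXL2 n) (hXsum n)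
      (by positivity : 0 < (1 + δ) * ((1 + δ) * x n))
    simp only [hXG] at h1 h2
    rw [show (1 + δ) * ((1 + δ) * x n) = (1 + δ) * (1 + δ) * x n by ring] at h1 h2
    rw [show δ * ((1 + δ) * x n) = δ * (1 + δ) * x n by ring] at h1
    rw [le_div_iff₀ hVn, div_mul_eq_mul_div, div_mul_cancel₀ _ hVn.ne']
    refine le_trans ?_ h1
    refine mul_le_mul_of_nonneg_left (by linarith) (tsum_nonneg fun i => hG0 _)
  refine (isEquivalent_iff_tendsto_one (hVpos.mono fun n hn => hn.ne')).2 ?_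
  have hrpow : ∀ f : ℝ → ℝ, Continuous f → f 0 = 1 →
      Tendsto (fun δ => (f δ * f δ) ^ (-t)) (𝓝[>] (0 : ℝ)) (𝓝 1) := fun f hf h0 => by
    have : ContinuousAt (fun δ => (f δ * f δ) ^ (-t)) 0 :=
      ((hf.mul hf).continuousAt).rpow_const (Or.inl (by simp [h0]))
    have h := this.tendsto
    simp only [h0, mul_one, Real.one_rpow] at h
    exact h.mono_left nhdsWithin_le_nhds
  have hsmall : ∀ᶠ δ : ℝ in 𝓝[>] 0, 0 < δ ∧ δ ≤ 1 / 4 := by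
    filter_upwards [Ioo_mem_nhdsGT (by norm_num : (0 : ℝ) < 1 / 4)] with δ hδ using ⟨hδ.1, hδ.2.le⟩
  refine tendsto_of_bounds (L := fun δ => ((1 + δ) * (1 + δ)) ^ (-t))
    (U := fun δ => ((1 - δ) * (1 - δ)) ^ (-t)) (hsmall.mono fun δ hδ => hlower δ hδ.1)
    (hsmall.mono fun δ hδ => herr δ hδ.1 hδ.2) (hsmall.mono fun δ hδ => ?_)
    (hsmall.mono fun δ hδ => ?_) (hrpow (fun δ => 1 + δ) (by fun_prop) (by simp))
    (hrpow (fun δ => 1 - δ) (by fun_prop) (by simp))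
  · have hδ := hδ.1
    have := (hVratio ((1 + δ) * (1 + δ)) (by positivity)).mul
      (((hx2 (δ * (1 + δ)) (by positivity)).const_sub 1).sub
        (hx2 ((1 + δ) * (1 + δ)) (by positivity)))
    simpa using this
  · have hδ1 : 0 < 1 - δ := by linarith [hδ.2]
    have hδ := hδ.1
    have := ((hVratio ((1 - δ) * (1 - δ)) (by positivity)).add
      ((hVratio (1 / 4) (by norm_num)).mul (hx2 (δ * (1 - δ)) (by positivity)))).add
      ((hx2 1 one_ne_zero).const_mul (Real.exp (4 ^ p * M) / κ))
    simpa using this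

end Core

/-! ### Normalising the field and checking the hypotheses of the core theorem. -/

section LinearField

/-- The summands enter only through their classes in `L²`, so the two sums are equal as functions,
not merely almost everywhere. -/
lemma l2Sum_congr {Ω ι : Type*} [MeasurableSpace Ω] {μ : Measure Ω} {f g : ι → Ω → ℝ}
    (h : ∀ i, f i =ᵐ[μ] g i) : l2Sum μ f = l2Sum μ g := by
  unfold l2Sum
  congr 1
  congr 1
  refine tsum_congr fun i => ?_
  by_cases hf : MemLp (f i) 2 μ
  · have hg := (memLp_congr_ae (h i)).1 hf
    rw [dif_pos hf, dif_pos hg]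
    exact (MemLp.toLp_eq_toLp_iff hf hg).2 (h i)
  · have hg := fun hg => hf ((memLp_congr_ae (h i)).2 hg)
    rw [dif_neg hf, dif_neg hg]

lemma partialSum_congr {Ω : Type*} [MeasurableSpace Ω] {μ : Measure Ω} {ξ ζ : ℤ × ℤ → Ω → ℝ}
    (h : ∀ q, ξ q =ᵐ[μ] ζ q) (a : ℤ × ℤ → ℝ) (G : Finset (ℤ × ℤ)) :
    partialSum μ a ξ G = partialSum μ a ζ G := by
  have hfield : ∀ p, field μ a ξ p = field μ a ζ p := fun p =>
    l2Sum_congr fun q => (h (p - q)).mono fun ω hω => by simp only [hω]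
  funext ω
  simp only [partialSum, hfield]

/-- `U_t` in terms of the normalised coefficients. -/
lemma U_eq_tsum {a : ℤ × ℤ → ℝ} {G : Finset (ℤ × ℤ)} (hpos : ∀ q, 0 < coeff a G q) {σ : ℝ}
    (hσ : 0 < σ) (hs : HasSum (fun q => (coeff a G q) ^ 2) (σ ^ 2)) (t : ℝ) :
    U a G t = ∑' q, (coeff a G q / σ) ^ t := by
  have h2 : D a G 2 = σ ^ 2 := by
    rw [D, ← hs.tsum_eq]
    exact tsum_congr fun q => by rw [Real.rpow_two, sq_abs]
  have h3 : (σ ^ 2 : ℝ) ^ (-t / 2) = σ ^ (-t) := by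
    rw [← Real.rpow_two, ← Real.rpow_mul hσ.le]
    congr 1
    ring
  rw [U, h2, h3, D, ← tsum_mul_left]
  refine tsum_congr fun q => ?_
  rw [abs_of_pos (hpos q), Real.div_rpow (hpos q).le hσ.le, Real.rpow_neg hσ.le]
  field_simp

variable {ι : Type*}

lemma tsum_rpow_pos [Nonempty ι] {c : ι → ℝ} (hc0 : ∀ i, 0 < c i)
    (hc : HasSum (fun i => (c i) ^ 2) 1) {t : ℝ} (ht : 2 ≤ t) : 0 < ∑' i, (c i) ^ t := by
  obtain ⟨i₀⟩ := ‹Nonempty ι›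
  exact (summable_rpow_of_hasSum_sq hc0 hc ht).tsum_pos
    (fun i => (Real.rpow_pos_of_pos (hc0 i) t).le) i₀ (Real.rpow_pos_of_pos (hc0 i₀) t)

/-- A second positive weight forces some `c i < 1`, whence strictness. It yields `log (1 / U) > 0`,
so `x n > 0` for every `n`, which the summability claim for every `n` requires. -/
lemma tsum_rpow_lt_one [Nontrivial ι] {c : ι → ℝ} (hc0 : ∀ i, 0 < c i)
    (hc : HasSum (fun i => (c i) ^ 2) 1) {t : ℝ} (ht : 2 < t) : ∑' i, (c i) ^ t < 1 := by
  obtain ⟨i, j, hij⟩ := exists_pair_ne ι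
  have hlt : c i < 1 := by
    classical
    have h := sum_le_hasSum {i, j} (fun i _ => sq_nonneg (c i)) hc
    rw [Finset.sum_pair hij] at h
    have := pow_pos (hc0 j) 2
    nlinarith [hc0 i]
  rw [← hc.tsum_eq]
  refine (summable_rpow_of_hasSum_sq hc0 hc ht.le).tsum_lt_tsum
    (rpow_le_sq_of_hasSum_sq hc0 hc ht.le) (i := i) ?_ hc.summable
  rw [← Real.rpow_two]
  exact Real.rpow_lt_rpow_of_exponent_gt (hc0 i) hlt ht

/-- Write `c ^ t = (c ^ 2) ^ ((t - 2) / 2) * c ^ 2`. This is how `ρ_n → 0` forces `U_{nt} → 0`. -/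
lemma tsum_rpow_le_rpow {c : ι → ℝ} (hc0 : ∀ i, 0 < c i)
    (hc : HasSum (fun i => (c i) ^ 2) 1) {t r : ℝ} (ht : 2 < t) (hr : ∀ i, (c i) ^ 2 ≤ r) :
    ∑' i, (c i) ^ t ≤ r ^ ((t - 2) / 2) := by
  have h : ∀ i, (c i) ^ t ≤ r ^ ((t - 2) / 2) * (c i) ^ 2 := by
    intro i
    have h1 : (c i) ^ t = ((c i) ^ 2) ^ ((t - 2) / 2) * (c i) ^ 2 := by
      rw [← Real.rpow_two, ← Real.rpow_mul (hc0 i).le, ← Real.rpow_add (hc0 i)]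
      congr 1
      ring
    rw [h1]
    exact mul_le_mul_of_nonneg_right (Real.rpow_le_rpow (sq_nonneg _) (hr i) (by linarith))
      (sq_nonneg _)
  refine ((summable_rpow_of_hasSum_sq hc0 hc ht.le).tsum_le_tsum h (hc.summable.mul_left _)).trans ?_
  rw [tsum_mul_left, hc.tsum_eq, mul_one]

variable {Ω : Type*} [MeasurableSpace Ω] {μ : Measure Ω} [IsProbabilityMeasure μ]

theorem tail_asymptotics_of_measurable
    {ξ : ℤ × ℤ → Ω → ℝ} (hξ : ∀ q, Measurable (ξ q)) (hindep : iIndepFun ξ μ)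
    (hident : ∀ q, IdentDistrib (ξ q) (ξ 0) μ μ)
    (hmean : ∫ ω, ξ 0 ω ∂μ = 0) (hvar : ∫ ω, (ξ 0 ω) ^ 2 ∂μ = 1)
    {a : ℤ × ℤ → ℝ} (ha : Summable (fun q => (a q) ^ 2)) {Γ : ℕ → Finset (ℤ × ℤ)}
    {b : ℕ → ℤ × ℤ → ℝ} (hb_def : ∀ n q, b n q = coeff a (Γ n) q)
    (hb_pos : ∀ n q, 0 < b n q)
    (hρ : Tendsto (fun n => rhoSq μ a ξ (Γ n)) atTop (𝓝 0))
    {t : ℝ} (ht : 2 < t) {h : ℝ → ℝ} (hh : SlowlyVarying h)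
    (htail : ∀ᶠ z : ℝ in atTop, μ.real {ω | z ≤ ξ 0 ω} = h z / z ^ t)
    {C : ℝ} (hC : Real.exp (t / 2) * (t + 2) / Real.sqrt 2 < C)
    {x : ℕ → ℝ} (hx : ∀ n, C * Real.sqrt (Real.log (U a (Γ n) t)⁻¹) ≤ x n)
    {y : ℕ → ℝ} (hy : ∀ n, y n = x n * sigma μ a ξ (Γ n)) :
    (∀ n, Summable (fun q : ℤ × ℤ => μ.real {ω | y n ≤ b n q * ξ (-q) ω})) ∧
    (∀ᶠ n in atTop, Summable (fun q : ℤ × ℤ => (b n q) ^ t * h (y n / b n q))) ∧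
    (fun n => μ.real {ω | y n ≤ partialSum μ a ξ (Γ n) ω}) ~[atTop]
      (fun n => ∑' q : ℤ × ℤ, μ.real {ω | y n ≤ b n q * ξ (-q) ω}) ∧
    (∀ᶠ n in atTop, ∑' q : ℤ × ℤ, μ.real {ω | y n ≤ b n q * ξ (-q) ω} =
      (y n) ^ (-t) * ∑' q : ℤ × ℤ, (b n q) ^ t * h (y n / b n q)) := by
  obtain rfl : b = fun n => coeff a (Γ n) := by
    funext n q
    exact hb_def n q
  simp only at hb_pos ⊢
  have hL20 : MemLp (ξ 0) 2 μ := by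
    rw [memLp_two_iff_integrable_sq (hξ 0).aestronglyMeasurable]
    -- The integral of a non-integrable function is `0` by convention, so variance one already
    -- forces square integrability.
    by_contra hcon
    rw [integral_undef hcon] at hvar
    exact zero_ne_one hvar
  have hL2 : ∀ q, MemLp (ξ q) 2 μ := fun q => (hident q).symm.memLp_snd hL20
  have hsqid : ∀ q, IdentDistrib (fun ω => (ξ q ω) ^ 2) (fun ω => (ξ 0 ω) ^ 2) μ μ := fun q =>
    (hident q).comp (u := fun z : ℝ => z ^ 2) (by fun_prop)
  have horth := orthonormal_toLp hindep hL2 (fun q => (hident q).integral_eq.trans hmean)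
    fun q => (hsqid q).integral_eq.trans hvar
  set σ : ℕ → ℝ := fun n => sigma μ a ξ (Γ n) with hσdef
  have hbs : ∀ n, HasSum (fun q => (coeff a (Γ n) q) ^ 2) (σ n ^ 2) := fun n =>
    hasSum_coeff_sq hL2 horth ha (Γ n)
  have hσ : ∀ n, 0 < σ n := fun n => by
    have h1 : 0 < σ n ^ 2 := by
      rw [← (hbs n).tsum_eq]
      exact (hbs n).summable.tsum_pos (fun _ => sq_nonneg _) 0 (pow_pos (hb_pos n 0) 2)
    exact lt_of_le_of_ne (Real.sqrt_nonneg _) fun h0 => by rw [← h0] at h1; simp at h1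
  have hc0 : ∀ n q, 0 < coeff a (Γ n) q / σ n := fun n q => div_pos (hb_pos n q) (hσ n)
  have hc : ∀ n, HasSum (fun q => (coeff a (Γ n) q / σ n) ^ 2) 1 := fun n => by
    have := (hbs n).div_const (σ n ^ 2)
    rw [div_self (pow_pos (hσ n) 2).ne'] at this
    simpa only [div_pow] using this
  have hU : ∀ n, U a (Γ n) t = ∑' q, (coeff a (Γ n) q / σ n) ^ t := fun n =>
    U_eq_tsum (hb_pos n) (hσ n) (hbs n) t
  simp only [hU] at hx
  have hUpos : ∀ n, 0 < ∑' q, (coeff a (Γ n) q / σ n) ^ t := fun n =>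
    tsum_rpow_pos (hc0 n) (hc n) ht.le
  have hUlt : ∀ n, ∑' q, (coeff a (Γ n) q / σ n) ^ t < 1 := fun n =>
    tsum_rpow_lt_one (hc0 n) (hc n) ht
  have hlogpos : ∀ n, 0 < Real.log (∑' q, (coeff a (Γ n) q / σ n) ^ t)⁻¹ := fun n =>
    Real.log_pos ((one_lt_inv₀ (hUpos n)).2 (hUlt n))
  have hC0 : 0 < C := lt_trans (by positivity) hC
  -- `C ^ 2 > exp t * (t + 2) ^ 2 / 2`, and `(t + 2) ^ 2 > 16` since `t > 2`.
  have hC2 : 8 * Real.exp t ≤ C ^ 2 := by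
    have h1 := pow_le_pow_left₀ (by positivity) hC.le 2
    refine le_trans ?_ h1
    rw [div_pow, mul_pow, Real.sq_sqrt (by norm_num), ← Real.exp_nat_mul, Nat.cast_ofNat,
      mul_div_cancel₀ t two_ne_zero, le_div_iff₀ (by norm_num)]
    nlinarith [Real.exp_pos t, mul_pos (Real.exp_pos t) (by nlinarith : 0 < (t + 2) ^ 2 - 16)]
  have hxpos : ∀ n, 0 < x n := fun n =>
    lt_of_lt_of_le (mul_pos hC0 (Real.sqrt_pos.2 (hlogpos n))) (hx n)
  have hlog : ∀ n, 8 * Real.exp t * Real.log (∑' q, (coeff a (Γ n) q / σ n) ^ t)⁻¹ ≤ x n ^ 2 := by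
    intro n
    have h1 := pow_le_pow_left₀ (by positivity) (hx n) 2
    rw [mul_pow, Real.sq_sqrt (hlogpos n).le] at h1
    exact (mul_le_mul_of_nonneg_right hC2 (hlogpos n).le).trans h1
  have hUρ : ∀ n, ∑' q, (coeff a (Γ n) q / σ n) ^ t ≤ (rhoSq μ a ξ (Γ n)) ^ ((t - 2) / 2) := by
    intro n
    refine tsum_rpow_le_rpow (hc0 n) (hc n) ht fun q => ?_
    rw [div_pow]
    refine le_ciSup (f := fun q => coeff a (Γ n) q ^ 2 / σ n ^ 2) ⟨1, ?_⟩ q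
    rintro _ ⟨q, rfl⟩
    simp only [← div_pow]
    exact le_hasSum (hc n) q fun _ _ => sq_nonneg _
  have hU0 : Tendsto (fun n => ∑' q, (coeff a (Γ n) q / σ n) ^ t) atTop (𝓝[>] 0) := by
    have h1 : Tendsto (fun n => (rhoSq μ a ξ (Γ n)) ^ ((t - 2) / 2)) atTop (𝓝 0) := by
      have := hρ.rpow_const (p := (t - 2) / 2) (Or.inr (by linarith))
      rwa [Real.zero_rpow (by linarith)] at this
    exact tendsto_nhdsWithin_iff.2 ⟨squeeze_zero (fun n => (hUpos n).le) hUρ h1,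
      Eventually.of_forall hUpos⟩
  have hxtop : Tendsto x atTop atTop :=
    tendsto_atTop_mono hx ((Real.tendsto_sqrt_atTop.comp (Real.tendsto_log_atTop.comp
      (tendsto_inv_nhdsGT_zero.comp hU0))).const_mul_atTop hC0)
  have hypos : ∀ n, 0 < y n := fun n => by
    rw [hy]
    exact mul_pos (hxpos n) (hσ n)
  have hxy : ∀ n q, x n / (coeff a (Γ n) q / σ n) = y n / coeff a (Γ n) q := fun n q => by
    rw [hy, div_div_eq_mul_div]
  have hterm : ∀ n q, μ.real {ω | y n ≤ coeff a (Γ n) q * ξ (-q) ω} =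
      μ.real {ω | y n / coeff a (Γ n) q ≤ ξ 0 ω} := fun n q => by
    have h1 := (hident (-q)).measure_mem_eq (measurableSet_Ici (a := y n / coeff a (Γ n) q))
    have h2 : {ω | y n ≤ coeff a (Γ n) q * ξ (-q) ω} =
        ξ (-q) ⁻¹' Set.Ici (y n / coeff a (Γ n) q) := by
      ext ω
      simp only [Set.mem_ofPred_eq, Set.mem_preimage, Set.mem_Ici]
      rw [div_le_iff₀' (hb_pos n q)]
    rw [h2, measureReal_def, h1]
    rfl
  have hsum : ∀ n, Summable fun q : ℤ × ℤ => μ.real {ω | y n ≤ coeff a (Γ n) q * ξ (-q) ω} := by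
    intro n
    refine summable_measureReal_ge (X := fun q ω => coeff a (Γ n) q * ξ (-q) ω)
      (fun q => (hL2 (-q)).const_mul _) ?_ (hypos n)
    refine (hbs n).summable.congr fun q => ?_
    simp only [mul_pow]
    rw [integral_const_mul, (hsqid (-q)).integral_eq, hvar, mul_one]
  -- the probabilities in terms of the slowly varying function
  have hev : ∀ᶠ n in atTop, ∀ q, (coeff a (Γ n) q) ^ t * h (y n / coeff a (Γ n) q) =
      (y n) ^ t * μ.real {ω | y n ≤ coeff a (Γ n) q * ξ (-q) ω} := by
    obtain ⟨K, hK⟩ := eventually_atTop.1 htail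
    filter_upwards [hxtop.eventually_ge_atTop K] with n hn q
    have h1 : K ≤ y n / coeff a (Γ n) q := by
      rw [← hxy]
      exact hn.trans (le_div_self (hxpos n).le (hc0 n q) (le_one_of_hasSum_sq (hc n) q))
    have hy0 := Real.rpow_pos_of_pos (hypos n) t
    have hb0 := Real.rpow_pos_of_pos (hb_pos n q) t
    rw [hterm, hK _ h1, Real.div_rpow (hypos n).le (hb_pos n q).le]
    field_simp
  refine ⟨hsum, ?_, ?_, ?_⟩
  · filter_upwards [hev] with n hn
    simp only [hn]
    exact (hsum n).mul_left _
  · have hmain := isEquivalent_tsum_tail (ζ := fun q => ξ (-q)) (Z := ξ 0)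
      (S := fun n ω => partialSum μ a ξ (Γ n) ω / σ n)
      (hindep.precomp neg_injective) (fun q => hξ (-q)) (fun q => hident (-q)) (hξ 0) hL20 hmean hvar
      ht (eventually_tail_pos hh htail) (fun l hl => tendsto_tail_ratio hh htail hl) hc0 hc ?_
      hxtop hlog
    · simp only [hxy] at hmain
      simp only [hterm]
      convert hmain using 5 with n ω
      rw [hy, le_div_iff₀ (hσ n)]
    · intro n ε hε
      refine (tendsto_measureReal_sum_coeff hL2 horth ha (Γ n) (mul_pos hε (hσ n))).congr fun Q => ?_
      congr 1
      ext ω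
      simp only [Set.mem_ofPred_eq]
      rw [← le_div_iff₀ (hσ n), ← abs_of_pos (hσ n), ← abs_div, abs_of_pos (hσ n), sub_div,
        Finset.sum_div]
      simp only [div_mul_eq_mul_div]
  · filter_upwards [hev] with n hn
    simp only [hn]
    rw [tsum_mul_left, ← mul_assoc, ← Real.rpow_add (hypos n), neg_add_cancel, Real.rpow_zero,
      one_mul]

end LinearField

theorem theorem2p2 {Ω : Type*} [MeasurableSpace Ω] (μ : Measure Ω) [IsProbabilityMeasure μ]
    -- i.i.d. innovations with mean zero and variance one
    (ξ : ℤ × ℤ → Ω → ℝ) (hindep : iIndepFun ξ μ) (hident : ∀ q, IdentDistrib (ξ q) (ξ 0) μ μ)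
    (hmean : ∫ ω, ξ 0 ω ∂μ = 0) (hvar : ∫ ω, (ξ 0 ω) ^ 2 ∂μ = 1)
    -- square summable coefficients, finite index sets
    (a : ℤ × ℤ → ℝ) (ha : Summable (fun q => (a q) ^ 2)) (Γ : ℕ → Finset (ℤ × ℤ))
    (b : ℕ → ℤ × ℤ → ℝ) (hb_def : ∀ n q, b n q = coeff a (Γ n) q)
    (hb_pos : ∀ n q, 0 < b n q)
    (hρ : Tendsto (fun n => rhoSq μ a ξ (Γ n)) atTop (𝓝 0))
    -- regularly varying right tail
    (t : ℝ) (ht : 2 < t) (h : ℝ → ℝ) (hh : SlowlyVarying h)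
    (htail : ∀ᶠ z : ℝ in atTop, μ.real {ω | z ≤ ξ 0 ω} = h z / z ^ t)
    (C : ℝ) (hC : Real.exp (t / 2) * (t + 2) / Real.sqrt 2 < C)
    (x : ℕ → ℝ) (hx : ∀ n, C * Real.sqrt (Real.log (U a (Γ n) t)⁻¹) ≤ x n)
    -- the threshold `x_n σ_n`
    (y : ℕ → ℝ) (hy : ∀ n, y n = x n * sigma μ a ξ (Γ n)) :
    (∀ n, Summable (fun q : ℤ × ℤ => μ.real {ω | y n ≤ b n q * ξ (-q) ω})) ∧
    (∀ᶠ n in atTop, Summable (fun q : ℤ × ℤ => (b n q) ^ t * h (y n / b n q))) ∧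
    (fun n => μ.real {ω | y n ≤ partialSum μ a ξ (Γ n) ω}) ~[atTop]
      (fun n => ∑' q : ℤ × ℤ, μ.real {ω | y n ≤ b n q * ξ (-q) ω}) ∧
    (fun n => μ.real {ω | y n ≤ partialSum μ a ξ (Γ n) ω}) ~[atTop]
      (fun n => (y n) ^ (-t) * ∑' q : ℤ × ℤ, (b n q) ^ t * h (y n / b n q)) ∧
    (∀ᶠ n in atTop, ∑' q : ℤ × ℤ, μ.real {ω | y n ≤ b n q * ξ (-q) ω} =
      (y n) ^ (-t) * ∑' q : ℤ × ℤ, (b n q) ^ t * h (y n / b n q)) := by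
  -- Identical distribution gives only a.e. measurability, so the innovations are replaced by
  -- measurable modifications; this changes neither the partial sums nor the probabilities involved.
  have hm : ∀ q, AEMeasurable (ξ q) μ := fun q => (hident q).aemeasurable_fst
  have hae : ∀ q, ξ q =ᵐ[μ] (hm q).mk (ξ q) := fun q => (hm q).ae_eq_mk
  let ζ : ℤ × ℤ → Ω → ℝ := fun q => (hm q).mk (ξ q)
  have hid : ∀ q, IdentDistrib (ξ q) (ζ q) μ μ := fun q => IdentDistrib.of_ae_eq (hm q) (hae q)
  have hS : ∀ G, partialSum μ a ξ G = partialSum μ a ζ G := partialSum_congr hae a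
  have hσ : ∀ G, sigma μ a ξ G = sigma μ a ζ G := fun G => by simp only [sigma, hS]
  have htail' : ∀ z, μ.real {ω | z ≤ ξ 0 ω} = μ.real {ω | z ≤ ζ 0 ω} := fun z =>
    congrArg ENNReal.toReal ((hid 0).measure_mem_eq measurableSet_Ici)
  have hterm : ∀ n q, μ.real {ω | y n ≤ b n q * ξ (-q) ω} = μ.real {ω | y n ≤ b n q * ζ (-q) ω} :=
    fun n q => congrArg ENNReal.toReal (((hid (-q)).comp
      (measurable_const_mul (b n q))).measure_mem_eq measurableSet_Ici)
  have hvar' : ∫ ω, (ζ 0 ω) ^ 2 ∂μ = 1 := by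
    rw [← hvar]
    exact integral_congr_ae ((hae 0).mono fun ω hω => by simp only [hω, ζ])
  simp only [rhoSq, hσ] at hρ hy
  simp only [htail'] at htail
  simp only [hterm, hS]
  obtain ⟨h1, h2, h3, h4⟩ := tail_asymptotics_of_measurable (fun q => (hm q).measurable_mk)
    (hindep.congr hae) (fun q => (hid q).symm.trans ((hident q).trans (hid 0)))
    ((hid 0).integral_eq.symm.trans hmean) hvar' ha hb_def hb_pos hρ ht hh htail hC hx hy
  exact ⟨h1, h2, h3, h3.congr_right h4, h4⟩
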